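/- There is a Weyl metric which is not a generalized $\tilde D$-metric. More precisely, let $B=\{x\in\mathbb R^3: |x|<1\}$, let $a=(-1,0,0)$, and for $x\in B$, $y\in\mathbb R^3$ put $$F(x,y)=\frac{\sqrt{(1-|a|^2|x|^4)|y|^2+\big(|x|^2\langle a,y\rangle-2\langle a,x\rangle\langle x,y\rangle\big)^2}}{1-|a|^2|x|^4}-\frac{|x|^2\langle a,y\rangle-2\langle a,x\rangle\langle x,y\rangle}{1-|a|^2|x|^4}.$$ Then $F$ is a Finsler metric on $B$; it is a Randers metric (the sum of a Riemannian metric $\alpha$ and a $1$-form of $\alpha$-norm less than $1$); it is of scalar flag curvature and of isotropic $S$-curvature (with respect to the Busemann–Hausdorff volume form), that is, $R^i{}_k=K(x,y)\,(F^2\delta^i_k-FF_{y^k}y^i)$ and $S=(n+1)c(x)F$ with $n=3$, for some functions $K$ on $TB\setminus 0$ and $c$ on $B$; it is a Weyl metric, that is, its Weyl curvature $$W^i{}_k=A^i{}_k-\frac1{n+1}\frac{\partial A^m{}_k}{\partial y^m}y^i,\qquad A^i{}_k=R^i{}_k-\frac{1}{n-1}R^m{}_m\delta^i_k,$$ vanishes;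 and it is not a generalized $\tilde D$-metric: there are no functions $\mu_r(x,y)$ on $TB\setminus 0$ with $$\tilde D_j{}^i{}_{kl|0}+\mu_r\tilde D_j{}^r{}_{kl}\,y^i=0 .$$ Here $R^i{}_k$ is the Riemann curvature and $G^i$ are the spray coefficients of $F$, $D_j{}^i{}_{kl}=\frac{\partial^3}{\partial y^j\partial y^k\partial y^l}\big(G^i-\frac1{n+1}\frac{\partial G^m}{\partial y^m}y^i\big)$ is the Douglas curvature, $|$ is the horizontal covariant derivative of the Berwald connection of $F$, the index $0$ means contraction with $y$, and $\tilde D_j{}^i{}_{kl}=D_j{}^i{}_{kl|0}$. -/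

import Mathlib

open scoped Matrix ContDiff

noncomputable section

namespace Finsler

/-- Coordinates on an open subset of `ℝⁿ`, and components of tangent vectors in these coordinates. -/
abbrev Coord (n : ℕ) := Fin n → ℝ

/-- A real function `f(x, y)` of the position `x` and the tangent vector `y`. -/
abbrev Scal (n : ℕ) := Coord n → Coord n → ℝ

variable {n : ℕ}

/-- `∂f/∂xᵏ`. -/
def dx (k : Fin n) (f : Scal n) : Scal n :=
  fun x y => fderiv ℝ (fun x' => f x' y) x (Pi.single k 1)

/-- `∂f/∂yᵏ`, written `f_{.k}`. -/
def dy (k : Fin n) (f : Scal n) : Scal n :=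
  fun x y => fderiv ℝ (fun y' => f x y') y (Pi.single k 1)

/-- The fundamental tensor `g_{ij} = ½ ∂²F²/∂yⁱ∂yʲ`. -/
def fundTensor (F : Scal n) (x y : Coord n) : Matrix (Fin n) (Fin n) ℝ :=
  Matrix.of fun i j => (1 / 2) * dy i (dy j (fun x y => F x y ^ 2)) x y

/-- `F` is a Finsler metric on the open set `Ω ⊆ ℝⁿ`. -/
structure IsFinslerMetric (Ω : Set (Coord n)) (F : Scal n) : Prop where
  isOpen : IsOpen Ω
  nonneg : ∀ x ∈ Ω, ∀ y, 0 ≤ F x y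
  smooth : ContDiffOn ℝ ∞ (fun p : Coord n × Coord n => F p.1 p.2) (Ω ×ˢ {0}ᶜ)
  homogeneous : ∀ x ∈ Ω, ∀ y, ∀ t : ℝ, 0 < t → F x (t • y) = t * F x y
  posDef : ∀ x ∈ Ω, ∀ y, y ≠ 0 → (fundTensor F x y).PosDef

/-- `F = α + β` on `Ω`, where `α = √(a_{ij}(x) yⁱ yʲ)` is a Riemannian metric,
`β = b_i(x) yⁱ` is a 1-form, and the `α`-norm of `β` is less than one. -/
def IsRandersMetric (Ω : Set (Coord n)) (F : Scal n) : Prop :=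
  ∃ (a : Coord n → Matrix (Fin n) (Fin n) ℝ) (b : Coord n → Coord n),
    (∀ i j, ContDiffOn ℝ ∞ (fun x => a x i j) Ω) ∧
    (∀ i, ContDiffOn ℝ ∞ (fun x => b x i) Ω) ∧
    ∀ x ∈ Ω, (a x).PosDef ∧ b x ⬝ᵥ ((a x)⁻¹ *ᵥ b x) < 1 ∧
      ∀ y, F x y = √(y ⬝ᵥ (a x *ᵥ y)) + b x ⬝ᵥ y

/-- The spray coefficients
`Gⁱ = ¼ gⁱˡ (∂²F²/∂xᵏ∂yˡ yᵏ - ∂F²/∂xˡ)`. -/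
def spray (F : Scal n) (i : Fin n) : Scal n := fun x y =>
  (1 / 4) * ∑ l, (fundTensor F x y)⁻¹ i l *
    (∑ k, dx k (dy l (fun x y => F x y ^ 2)) x y * y k - dx l (fun x y => F x y ^ 2) x y)

/-- The connection coefficients `Nⁱ_j = Gⁱ_{.j}`. -/
def nonlinConn (F : Scal n) (i j : Fin n) : Scal n := dy j (spray F i)

/-- The coefficients `Gⁱ_{.j.k}` of the Berwald connection. -/
def berwaldConn (F : Scal n) (i j k : Fin n) : Scal n := dy k (nonlinConn F i j)

/-- The Riemann curvature `Rⁱ_k`. -/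
def riemann (F : Scal n) (i k : Fin n) : Scal n := fun x y =>
  2 * dx k (spray F i) x y
    - ∑ m, dx m (dy k (spray F i)) x y * y m
    + 2 * ∑ m, spray F m x y * dy m (dy k (spray F i)) x y
    - ∑ m, dy m (spray F i) x y * dy k (spray F m) x y

/-- `F` is of scalar flag curvature on `Ω`: `Rⁱ_k = K (F² δⁱ_k - F F_{.k} yⁱ)` for a scalar
function `K = K(x, y)`. -/
def HasScalarFlagCurvature (Ω : Set (Coord n)) (F : Scal n) : Prop :=
  ∃ K : Scal n, ∀ x ∈ Ω, ∀ y, y ≠ 0 → ∀ i k,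
    riemann F i k x y =
      K x y * (F x y ^ 2 * (if i = k then 1 else 0) - F x y * dy k F x y * y i)

/-- `Aⁱ_k = Rⁱ_k - R δⁱ_k` with `R = Rᵐ_m / (n - 1)`. -/
def riemannTraceFree (F : Scal n) (i k : Fin n) : Scal n := fun x y =>
  riemann F i k x y - (∑ m, riemann F m m x y) / ((n : ℝ) - 1) * (if i = k then 1 else 0)

/-- The Weyl curvature `Wⁱ_k = Aⁱ_k - (1 / (n + 1)) Aᵐ_{k.m} yⁱ`. -/
def weyl (F : Scal n) (i k : Fin n) : Scal n := fun x y =>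
  riemannTraceFree F i k x y
    - 1 / ((n : ℝ) + 1) * (∑ m, dy m (riemannTraceFree F m k) x y) * y i

/-- `F` is a Weyl metric on `Ω`: its Weyl curvature vanishes. -/
def IsWeylMetric (Ω : Set (Coord n)) (F : Scal n) : Prop :=
  ∀ x ∈ Ω, ∀ y, y ≠ 0 → ∀ i k, weyl F i k x y = 0

/-- The density `σ_F(x)` of the Busemann-Hausdorff volume form. -/
def bhDensity (F : Scal n) (x : Coord n) : ℝ :=
  MeasureTheory.volume.real {v : Coord n | v ⬝ᵥ v < 1} /
    MeasureTheory.volume.real {v : Coord n | F x v < 1}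

/-- The distortion `τ = log (√(det g_{ij}) / σ_F)`. -/
def distortion (F : Scal n) : Scal n := fun x y =>
  Real.log (√((fundTensor F x y).det) / bhDensity F x)

/-- The `S`-curvature: the derivative of the distortion along geodesics, that is, along the
spray `yᵐ ∂/∂xᵐ - 2 Gᵐ ∂/∂yᵐ`. -/
def sCurvature (F : Scal n) : Scal n := fun x y =>
  ∑ m, (y m * dx m (distortion F) x y - 2 * spray F m x y * dy m (distortion F) x y)

/-- `F` is of isotropic `S`-curvature on `Ω`: `S = (n + 1) c F` for a scalar function
`c = c(x)`. -/
def HasIsotropicSCurvature (Ω : Set (Coord n)) (F : Scal n) : Prop :=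
  ∃ c : Coord n → ℝ, ∀ x ∈ Ω, ∀ y, y ≠ 0 → sCurvature F x y = ((n : ℝ) + 1) * c x * F x y

/-- The components of a tensor of type `(1, 3)` on the slit tangent bundle: `T i j k l` stands for
`T_jⁱ_kl`, the upper index comes first. -/
abbrev Tensor13 (n : ℕ) := Fin n → Fin n → Fin n → Fin n → Scal n

/-- The Douglas curvature
`D_jⁱ_kl = ∂³Gⁱ/∂yʲ∂yᵏ∂yˡ - (1 / (n + 1)) ∂³(Gᵐ_{.m} yⁱ)/∂yʲ∂yᵏ∂yˡ`,
whose first term is the Berwald curvature `B_jⁱ_kl`. -/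
def douglas (F : Scal n) : Tensor13 n := fun i j k l x y =>
  dy j (dy k (dy l (spray F i))) x y
    - 1 / ((n : ℝ) + 1) *
      dy j (dy k (dy l (fun x y => (∑ m, dy m (spray F m) x y) * y i))) x y

/-- The horizontal covariant derivative `T_jⁱ_kl|m` with respect to the Berwald connection. -/
def hDeriv (F : Scal n) (T : Tensor13 n) (i j k l m : Fin n) : Scal n := fun x y =>
  dx m (T i j k l) x y
    - ∑ r, nonlinConn F r m x y * dy r (T i j k l) x y
    + ∑ r, berwaldConn F i r m x y * T r j k l x y
    - ∑ r, berwaldConn F r j m x y * T i r k l x y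
    - ∑ r, berwaldConn F r k m x y * T i j r l x y
    - ∑ r, berwaldConn F r l m x y * T i j k r x y

/-- `T_jⁱ_kl|0 = T_jⁱ_kl|m yᵐ`. -/
def hDeriv0 (F : Scal n) (T : Tensor13 n) : Tensor13 n := fun i j k l x y =>
  ∑ m, hDeriv F T i j k l m x y * y m

/-- The curvature `D̃_jⁱ_kl = D_jⁱ_kl|0`. -/
def dTilde (F : Scal n) : Tensor13 n := hDeriv0 F (douglas F)

/-- `F` is a generalized `D̃`-metric on `Ω`:
`D̃_jⁱ_kl|0 + μ_r D̃_jʳ_kl yⁱ = 0` for some coefficients `μ_r = μ_r(x, y)`. -/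
def IsGeneralizedDTildeMetric (Ω : Set (Coord n)) (F : Scal n) : Prop :=
  ∃ μ : Fin n → Scal n, ∀ x ∈ Ω, ∀ y, y ≠ 0 → ∀ i j k l,
    hDeriv0 F (dTilde F) i j k l x y + (∑ r, μ r x y * dTilde F r j k l x y) * y i = 0

/-- The function `F = α + β` with
`α = √((1 - |a|²|x|⁴)|y|² + (|x|²⟨a,y⟩ - 2⟨a,x⟩⟨x,y⟩)²) / (1 - |a|²|x|⁴)` and
`β = -(|x|²⟨a,y⟩ - 2⟨a,x⟩⟨x,y⟩) / (1 - |a|²|x|⁴)`, for a constant vector `a`. -/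
def randersExample (a : Coord n) : Scal n := fun x y =>
  √((1 - (a ⬝ᵥ a) * (x ⬝ᵥ x) ^ 2) * (y ⬝ᵥ y)
      + ((x ⬝ᵥ x) * (a ⬝ᵥ y) - 2 * (a ⬝ᵥ x) * (x ⬝ᵥ y)) ^ 2)
      / (1 - (a ⬝ᵥ a) * (x ⬝ᵥ x) ^ 2)
    + -(((x ⬝ᵥ x) * (a ⬝ᵥ y) - 2 * (a ⬝ᵥ x) * (x ⬝ᵥ y)) / (1 - (a ⬝ᵥ a) * (x ⬝ᵥ x) ^ 2))

/-- The open unit ball of `ℝ³`. -/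
def unitBall3 : Set (Coord 3) := {x | x ⬝ᵥ x < 1}

end Finsler

end

/-! The metric solves Zermelo's navigation problem on Euclidean space with wind `W = |x|² a -
2⟨a,x⟩x`: `F` is the positive root of `|y - F W| = F`. For `|a| = 1` one has `|W| = |x|²`, so with
`λ = 1 - |x|⁴`, `W₀ = ⟨W,y⟩` and `A = λF + W₀` this reads `|y|² = λF² + 2FW₀`. Writing `y = A∇F + F
W`, with `∇F = (F_{.l})`, turns the tensor identities below into algebraic ones in `F`, `F_{.l}` and
inner products of `a`, `x`, `y`.

The spray is `G = Fp + F²q + ⟨a,x⟩Fy`, with `p` linear in `y` and `q` independent of `y`. It is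
identified through the Euler–Lagrange equations: along the field `(y, -2G)` the function `F` is
constant (`dRanders_flow`) and `F_{.l}` has derivative `∂F/∂xˡ` (`dGrad_flow`). Substitution then
gives the flag curvature `K = 3⟨a,y⟩/F + 3⟨a,x⟩² - 2|x|²`; the vanishing of the Weyl curvature
follows from Euler's relation. The unit balls of `F` are translated Euclidean balls and `det g =
(F/A)⁴`, so the `S`-curvature comes from the derivative of `log A` along the spray, which is
`-2⟨a,x⟩F` (`dRad_flow`).

For the negative part, the Douglas curvature is the symmetrization `F_{.j.k} Zⁱ_l + F_{.j.l} Zⁱ_k +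
F_{.k.l} Zⁱ_j`. Since `F_{.j.k|0} = 0` (`dHess_flow`) and `Zⁱ_l|0 = yⁱu_l` (`zed_horizontal`), the
tensor `D̃` has the same form with `yⁱu_l` in place of `Zⁱ_l`, and `D̃_{|0}` has it with `yⁱu_l|0`.
Where `a`, `x`, `y` are orthogonal, the component of `u` along `x` vanishes but that of `u_{|0}`
does not, so no `μ` can balance the two tensors. -/

noncomputable section

namespace Finsler

/-! ### Joint differentials in `(x, y)`: partial, radial and spray derivatives as values of one
function `d ξ ζ` -/

variable {n : ℕ}

/-- `f(x, y)` is differentiable at `(x, y)`, with derivative `d ξ ζ` in the direction `(ξ, ζ)`. -/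
def HasD (f : Scal n) (x y : Coord n) (d : Coord n → Coord n → ℝ) : Prop :=
  ∃ L : Coord n × Coord n →L[ℝ] ℝ,
    HasFDerivAt (fun p : Coord n × Coord n => f p.1 p.2) L (x, y) ∧ ∀ ξ ζ, L (ξ, ζ) = d ξ ζ

namespace HasD

variable {f g : Scal n} {x y : Coord n} {d e : Coord n → Coord n → ℝ}

theorem congr_deriv (hf : HasD f x y d) (h : ∀ ξ ζ, d ξ ζ = e ξ ζ) : HasD f x y e := by
  obtain ⟨L, hL, hd⟩ := hf
  exact ⟨L, hL, fun ξ ζ => (hd ξ ζ).trans (h ξ ζ)⟩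

theorem dx_eq (hf : HasD f x y d) (k : Fin n) : dx k f x y = d (Pi.single k 1) 0 := by
  obtain ⟨L, hL, hd⟩ := hf
  have h := hL.comp x (hasFDerivAt_prodMk_left (𝕜 := ℝ) x y)
  have h' : HasFDerivAt (fun x' => f x' y) (L.comp (ContinuousLinearMap.inl ℝ _ _)) x := h
  simp [dx, h'.fderiv, hd]

theorem dy_eq (hf : HasD f x y d) (k : Fin n) : dy k f x y = d 0 (Pi.single k 1) := by
  obtain ⟨L, hL, hd⟩ := hf
  have h := hL.comp y (hasFDerivAt_prodMk_right (𝕜 := ℝ) x y)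
  have h' : HasFDerivAt (fun y' => f x y') (L.comp (ContinuousLinearMap.inr ℝ _ _)) y := h
  simp [dy, h'.fderiv, hd]

/-- Lets a sum of partial derivatives be read as one value of `d`: `(0, y)` gives the Euler
operator, `(y, -2G)` the derivative along the spray. -/
theorem apply_eq_sum (hf : HasD f x y d) (ξ ζ : Coord n) :
    d ξ ζ = ∑ m, ξ m * dx m f x y + ∑ m, ζ m * dy m f x y := by
  have hx := hf.dx_eq
  have hy := hf.dy_eq
  obtain ⟨L, -, hd⟩ := hf
  have hv : ∀ v : Coord n, v = ∑ m, v m • Pi.single m (1 : ℝ) := fun v => by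
    ext i
    simp [Finset.sum_apply, Pi.single_apply]
  have h1 : ∀ v : Coord n, L (v, 0) = ∑ m, v m * d (Pi.single m 1) 0 := fun v => by
    have := congrArg (L.comp (ContinuousLinearMap.inl ℝ (Coord n) (Coord n))) (hv v)
    rw [map_sum] at this
    simpa only [map_smul, ContinuousLinearMap.comp_apply, ContinuousLinearMap.inl_apply, hd,
      smul_eq_mul] using this
  have h2 : ∀ v : Coord n, L (0, v) = ∑ m, v m * d 0 (Pi.single m 1) := fun v => by
    have := congrArg (L.comp (ContinuousLinearMap.inr ℝ (Coord n) (Coord n))) (hv v)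
    rw [map_sum] at this
    simpa only [map_smul, ContinuousLinearMap.comp_apply, ContinuousLinearMap.inr_apply, hd,
      smul_eq_mul] using this
  simp only [hx, hy, ← h1, ← h2]
  rw [← hd, ← map_add]
  simp

theorem const (r : ℝ) : HasD (fun _ _ => r) x y (fun _ _ => 0) :=
  ⟨0, hasFDerivAt_const _ _, fun _ _ => rfl⟩

theorem fst (i : Fin n) : HasD (fun x _ => x i) x y (fun ξ _ => ξ i) :=
  ⟨_, ((ContinuousLinearMap.proj (R := ℝ) (φ := fun _ : Fin n => ℝ) i).comp
    (ContinuousLinearMap.fst ℝ (Coord n) (Coord n))).hasFDerivAt, fun _ _ => rfl⟩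

theorem snd (i : Fin n) : HasD (fun _ y => y i) x y (fun _ ζ => ζ i) :=
  ⟨_, ((ContinuousLinearMap.proj (R := ℝ) (φ := fun _ : Fin n => ℝ) i).comp
    (ContinuousLinearMap.snd ℝ (Coord n) (Coord n))).hasFDerivAt, fun _ _ => rfl⟩

theorem add (hf : HasD f x y d) (hg : HasD g x y e) :
    HasD (fun x y => f x y + g x y) x y (fun ξ ζ => d ξ ζ + e ξ ζ) := by
  obtain ⟨L, hL, hd⟩ := hf
  obtain ⟨M, hM, he⟩ := hg
  exact ⟨L + M, hL.add hM, fun ξ ζ => by simp [hd, he]⟩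

theorem sub (hf : HasD f x y d) (hg : HasD g x y e) :
    HasD (fun x y => f x y - g x y) x y (fun ξ ζ => d ξ ζ - e ξ ζ) := by
  obtain ⟨L, hL, hd⟩ := hf
  obtain ⟨M, hM, he⟩ := hg
  exact ⟨L - M, hL.sub hM, fun ξ ζ => by simp [hd, he]⟩

theorem neg (hf : HasD f x y d) : HasD (fun x y => -f x y) x y (fun ξ ζ => -d ξ ζ) := by
  obtain ⟨L, hL, hd⟩ := hf
  exact ⟨-L, hL.neg, fun ξ ζ => by simp [hd]⟩

theorem mul (hf : HasD f x y d) (hg : HasD g x y e) :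
    HasD (fun x y => f x y * g x y) x y (fun ξ ζ => d ξ ζ * g x y + f x y * e ξ ζ) := by
  obtain ⟨L, hL, hd⟩ := hf
  obtain ⟨M, hM, he⟩ := hg
  exact ⟨_, hL.mul hM, fun ξ ζ => by simp [hd, he]; ring⟩

theorem const_mul (r : ℝ) (hf : HasD f x y d) :
    HasD (fun x y => r * f x y) x y (fun ξ ζ => r * d ξ ζ) :=
  ((const r).mul hf).congr_deriv fun ξ ζ => by ring

theorem sq (hf : HasD f x y d) :
    HasD (fun x y => f x y ^ 2) x y (fun ξ ζ => 2 * f x y * d ξ ζ) := by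
  obtain ⟨L, hL, hd⟩ := hf
  exact ⟨_, hL.pow 2, fun ξ ζ => by simp [hd]⟩

theorem comp {φ : ℝ → ℝ} {φ' : ℝ} (hφ : HasDerivAt φ φ' (f x y)) (hf : HasD f x y d) :
    HasD (fun x y => φ (f x y)) x y (fun ξ ζ => φ' * d ξ ζ) := by
  obtain ⟨L, hL, hd⟩ := hf
  exact ⟨_, HasDerivAt.comp_hasFDerivAt (x, y) hφ hL, fun ξ ζ => by simp [hd]⟩

theorem div (hf : HasD f x y d) (hg : HasD g x y e) (h0 : g x y ≠ 0) :
    HasD (fun x y => f x y / g x y) x y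
      (fun ξ ζ => (d ξ ζ - f x y / g x y * e ξ ζ) / g x y) := by
  have h := hf.mul (comp (hasDerivAt_inv h0) hg)
  simp only [← div_eq_mul_inv] at h
  refine h.congr_deriv fun ξ ζ => ?_
  field_simp
  ring

theorem sum {ι : Type*} (s : Finset ι) {f : ι → Scal n} {d : ι → Coord n → Coord n → ℝ}
    (hf : ∀ i ∈ s, HasD (f i) x y (d i)) :
    HasD (fun x y => ∑ i ∈ s, f i x y) x y (fun ξ ζ => ∑ i ∈ s, d i ξ ζ) := by
  classical
  induction s using Finset.induction_on with
  | empty => simpa using const 0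
  | insert i s hi ih =>
    simp only [Finset.sum_insert hi]
    exact (hf i (Finset.mem_insert_self i s)).add
      (ih fun j hj => hf j (Finset.mem_insert_of_mem hj))

/-- The closed forms hold only for `x ∈ Ω` and `y ≠ 0`. This set is open, so they may still be
differentiated, and iterated derivatives are computed one at a time. -/
theorem congr_fun {Ω : Set (Coord n)} (hΩ : IsOpen Ω) (hg : HasD g x y d) (hx : x ∈ Ω)
    (hy : y ≠ 0) (h : ∀ x ∈ Ω, ∀ y, y ≠ 0 → f x y = g x y) : HasD f x y d := by
  obtain ⟨L, hL, hd⟩ := hg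
  refine ⟨L, hL.congr_of_eventuallyEq ?_, hd⟩
  filter_upwards [(hΩ.prod isOpen_compl_singleton).mem_nhds (show (x, y) ∈ Ω ×ˢ {0}ᶜ from ⟨hx, hy⟩)]
    with p hp
  exact h p.1 hp.1 p.2 hp.2

theorem dotProduct {f g : Fin n → Scal n} {d e : Fin n → Coord n → Coord n → ℝ}
    (hf : ∀ i, HasD (f i) x y (d i)) (hg : ∀ i, HasD (g i) x y (e i)) :
    HasD (fun x y => (fun i => f i x y) ⬝ᵥ (fun i => g i x y)) x y
      (fun ξ ζ => (fun i => d i ξ ζ) ⬝ᵥ (fun i => g i x y) +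
        (fun i => f i x y) ⬝ᵥ (fun i => e i ξ ζ)) := by
  refine (sum Finset.univ fun i _ => (hf i).mul (hg i)).congr_deriv fun ξ ζ => ?_
  simp [_root_.dotProduct, Finset.sum_add_distrib]

theorem dotProduct_fst_self :
    HasD (fun x _ => x ⬝ᵥ x) x y (fun ξ _ => 2 * (x ⬝ᵥ ξ)) :=
  (dotProduct fst fst).congr_deriv fun ξ ζ => by
    rw [dotProduct_comm (fun i => ξ i)]; ring

theorem dotProduct_snd_self :
    HasD (fun _ y => y ⬝ᵥ y) x y (fun _ ζ => 2 * (y ⬝ᵥ ζ)) :=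
  (dotProduct snd snd).congr_deriv fun ξ ζ => by
    rw [dotProduct_comm (fun i => ζ i)]; ring

theorem dotProduct_fst_snd :
    HasD (fun x y => x ⬝ᵥ y) x y (fun ξ ζ => y ⬝ᵥ ξ + x ⬝ᵥ ζ) :=
  (dotProduct fst snd).congr_deriv fun ξ ζ => by
    rw [dotProduct_comm (fun i => ξ i)]

theorem dotProduct_const_fst (a : Coord n) :
    HasD (fun x _ => a ⬝ᵥ x) x y (fun ξ _ => a ⬝ᵥ ξ) :=
  (dotProduct (fun i => const (a i)) fst).congr_deriv fun ξ ζ => by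
    simp [_root_.dotProduct]

theorem dotProduct_const_snd (a : Coord n) :
    HasD (fun _ y => a ⬝ᵥ y) x y (fun _ ζ => a ⬝ᵥ ζ) :=
  (dotProduct (fun i => const (a i)) snd).congr_deriv fun ξ ζ => by
    simp [_root_.dotProduct]

theorem dy_eq_of_eqOn {Ω : Set (Coord n)} (hΩ : IsOpen Ω) (hg : HasD g x y d) (hx : x ∈ Ω)
    (hy : y ≠ 0) (h : ∀ x ∈ Ω, ∀ y, y ≠ 0 → f x y = g x y) (k : Fin n) :
    dy k f x y = d 0 (Pi.single k 1) :=
  (hg.congr_fun hΩ hx hy h).dy_eq k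

end HasD

-- The navigation problem and the first derivatives of `F` and `A`

local notation "𝓕" => randersExample

/-- `λ = 1 - |x|⁴`. -/
def lam (x : Coord n) : ℝ := 1 - (x ⬝ᵥ x) ^ 2

/-- The vector field `W = |x|² a - 2 ⟨a, x⟩ x` of the navigation problem solved by `F`. -/
def drift (a x : Coord n) (i : Fin n) : ℝ := (x ⬝ᵥ x) * a i - 2 * (a ⬝ᵥ x) * x i

/-- `W₀ = ⟨W, y⟩`. -/
def drift0 (a : Coord n) : Scal n := fun x y =>
  (x ⬝ᵥ x) * (a ⬝ᵥ y) - 2 * (a ⬝ᵥ x) * (x ⬝ᵥ y)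

/-- `A = √(λ |y|² + W₀²)`. -/
def rad (a : Coord n) : Scal n := fun x y => √(lam x * (y ⬝ᵥ y) + drift0 a x y ^ 2)

/-- The components `F_{.l} = (y_l - F W_l) / A`. -/
def grad (a : Coord n) (l : Fin n) : Scal n := fun x y =>
  (y l - 𝓕 a x y * drift a x l) / rad a x y

theorem drift_dotProduct (a x y : Coord n) : drift a x ⬝ᵥ y = drift0 a x y := by
  have : drift a x = (x ⬝ᵥ x) • a - (2 * (a ⬝ᵥ x)) • x := by
    ext i; simp [drift]
  rw [this, sub_dotProduct, smul_dotProduct, smul_dotProduct, drift0]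
  simp

section

variable {a x y : Coord n}

theorem dot_self_nonneg (x : Coord n) : 0 ≤ x ⬝ᵥ x :=
  Finset.sum_nonneg fun i _ => mul_self_nonneg (x i)

theorem drift_dotProduct_self (ha : a ⬝ᵥ a = 1) :
    drift a x ⬝ᵥ drift a x = (x ⬝ᵥ x) ^ 2 := by
  rw [drift_dotProduct, drift0, dotProduct_comm a (drift a x), dotProduct_comm x (drift a x),
    drift_dotProduct, drift_dotProduct, drift0, drift0, dotProduct_comm x a, ha]
  ring

theorem lam_pos (hx : x ⬝ᵥ x < 1) : 0 < lam x := by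
  have := dot_self_nonneg x
  have : (x ⬝ᵥ x) ^ 2 < 1 := by nlinarith
  simpa [lam] using this

theorem dotProduct_self_pos' (hy : y ≠ 0) : 0 < y ⬝ᵥ y :=
  lt_of_le_of_ne (dot_self_nonneg y) fun h => hy (dotProduct_self_eq_zero.1 h.symm)

theorem rad_sq_pos (hx : x ⬝ᵥ x < 1) (hy : y ≠ 0) :
    0 < lam x * (y ⬝ᵥ y) + drift0 a x y ^ 2 := by
  have := mul_pos (lam_pos hx) (dotProduct_self_pos' hy)
  positivity

theorem rad_pos (hx : x ⬝ᵥ x < 1) (hy : y ≠ 0) : 0 < rad a x y :=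
  Real.sqrt_pos.2 (rad_sq_pos hx hy)

theorem rad_sq (hx : x ⬝ᵥ x < 1) :
    rad a x y ^ 2 = lam x * (y ⬝ᵥ y) + drift0 a x y ^ 2 := by
  have := mul_nonneg (lam_pos hx).le (dot_self_nonneg y)
  exact Real.sq_sqrt (by positivity)

theorem randersExample_eq (ha : a ⬝ᵥ a = 1) (x y : Coord n) :
    𝓕 a x y = (rad a x y - drift0 a x y) / lam x := by
  simp only [randersExample, ha, rad, drift0, lam]
  ring_nf

theorem rad_eq (ha : a ⬝ᵥ a = 1) (hx : x ⬝ᵥ x < 1) :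
    rad a x y = lam x * 𝓕 a x y + drift0 a x y := by
  rw [randersExample_eq ha]
  field_simp [(lam_pos hx).ne']
  ring

/-- The navigation equation `|y - F W|² = F²`, expanded with `|W|² = 1 - λ`. Together with `rad_eq`
it removes the square root: `A` and `|y|²` become polynomials in `F`, `W₀` and `λ`. -/
theorem quadratic_eq (ha : a ⬝ᵥ a = 1) (hx : x ⬝ᵥ x < 1) :
    y ⬝ᵥ y = lam x * 𝓕 a x y ^ 2 + 2 * 𝓕 a x y * drift0 a x y := by
  have h := rad_sq (a := a) (y := y) hx
  rw [rad_eq ha hx] at h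
  apply mul_left_cancel₀ (lam_pos hx).ne'
  linear_combination -h

theorem randersExample_pos (ha : a ⬝ᵥ a = 1) (hx : x ⬝ᵥ x < 1) (hy : y ≠ 0) :
    0 < 𝓕 a x y := by
  rw [randersExample_eq ha]
  refine div_pos (sub_pos.2 ?_) (lam_pos hx)
  refine lt_of_le_of_lt (le_abs_self _) ?_
  rw [← Real.sqrt_sq_eq_abs]
  refine Real.sqrt_lt_sqrt (sq_nonneg _) ?_
  have := mul_pos (lam_pos hx) (dotProduct_self_pos' hy)
  linarith

theorem hasD_lam : HasD (fun x _ => lam x) x y (fun ξ _ => -4 * (x ⬝ᵥ x) * (x ⬝ᵥ ξ)) :=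
  ((HasD.const 1).sub HasD.dotProduct_fst_self.sq).congr_deriv fun ξ ζ => by ring

theorem hasD_drift (l : Fin n) :
    HasD (fun x _ => drift a x l) x y
      (fun ξ _ => 2 * (x ⬝ᵥ ξ) * a l - 2 * (a ⬝ᵥ ξ) * x l - 2 * (a ⬝ᵥ x) * ξ l) :=
  ((HasD.dotProduct_fst_self.mul (HasD.const (a l))).sub
    (((HasD.dotProduct_const_fst a).const_mul 2).mul (HasD.fst l))).congr_deriv
    fun ξ ζ => by ring

/-- The differential of `W₀`. -/
def dDrift0 (a x y ξ ζ : Coord n) : ℝ :=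
  2 * (x ⬝ᵥ ξ) * (a ⬝ᵥ y) + (x ⬝ᵥ x) * (a ⬝ᵥ ζ) - 2 * (a ⬝ᵥ ξ) * (x ⬝ᵥ y)
    - 2 * (a ⬝ᵥ x) * (y ⬝ᵥ ξ + x ⬝ᵥ ζ)

theorem hasD_drift0 : HasD (drift0 a) x y (dDrift0 a x y) :=
  ((HasD.dotProduct_fst_self.mul (HasD.dotProduct_const_snd a)).sub
    (((HasD.dotProduct_const_fst a).const_mul 2).mul HasD.dotProduct_fst_snd)).congr_deriv
    fun ξ ζ => by simp only [dDrift0]; ring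

/-- The differential of `F`. -/
def dRanders (a x y ξ ζ : Coord n) : ℝ :=
  (y ⬝ᵥ ζ - 𝓕 a x y * dDrift0 a x y ξ ζ + 2 * 𝓕 a x y ^ 2 * (x ⬝ᵥ x) * (x ⬝ᵥ ξ)) / rad a x y

/-- The differential of `A`. -/
def dRad (a x y ξ ζ : Coord n) : ℝ :=
  -4 * (x ⬝ᵥ x) * (x ⬝ᵥ ξ) * 𝓕 a x y + lam x * dRanders a x y ξ ζ + dDrift0 a x y ξ ζ

theorem isOpen_unitBall : IsOpen {x : Coord n | x ⬝ᵥ x < 1} :=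
  isOpen_lt (by simp only [dotProduct]; fun_prop) continuous_const

theorem hasD_randersExample (ha : a ⬝ᵥ a = 1) (hx : x ⬝ᵥ x < 1) (hy : y ≠ 0) :
    HasD (𝓕 a) x y (dRanders a x y) := by
  have h1 : HasD (rad a) x y _ := HasD.comp (φ := Real.sqrt)
    (f := fun x y => lam x * (y ⬝ᵥ y) + drift0 a x y ^ 2)
    (Real.hasDerivAt_sqrt (rad_sq_pos (a := a) hx hy).ne')
    ((hasD_lam.mul HasD.dotProduct_snd_self).add hasD_drift0.sq)
  have h2 := (h1.sub (hasD_drift0 (a := a))).div hasD_lam (lam_pos hx).ne'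
  simp only [← randersExample_eq ha] at h2
  refine h2.congr_deriv fun ξ ζ => ?_
  change (1 / (2 * rad a x y) * _ - _ - _) / _ = _
  have hr := rad_pos (a := a) hx hy
  have hl := lam_pos hx
  have hq := quadratic_eq (y := y) ha hx
  have hA := rad_eq (y := y) ha hx
  rw [dRanders]
  field_simp
  rw [hq, hA]
  ring

theorem hasD_rad (ha : a ⬝ᵥ a = 1) (hx : x ⬝ᵥ x < 1) (hy : y ≠ 0) :
    HasD (rad a) x y (dRad a x y) := by
  refine HasD.congr_fun isOpen_unitBall (HasD.congr_deriv
    ((hasD_lam.mul (hasD_randersExample ha hx hy)).add hasD_drift0) fun ξ ζ => ?_) hx hy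
    fun x hx y _ => rad_eq ha hx
  rw [dRad]

/-- The differential of `F_{.l}`. -/
def dGrad (a : Coord n) (l : Fin n) (x y ξ ζ : Coord n) : ℝ :=
  (ζ l - dRanders a x y ξ ζ * drift a x l - 𝓕 a x y *
    (2 * (x ⬝ᵥ ξ) * a l - 2 * (a ⬝ᵥ ξ) * x l - 2 * (a ⬝ᵥ x) * ξ l)
      - grad a l x y * dRad a x y ξ ζ) / rad a x y

theorem hasD_grad (ha : a ⬝ᵥ a = 1) (hx : x ⬝ᵥ x < 1) (hy : y ≠ 0) (l : Fin n) :
    HasD (grad a l) x y (dGrad a l x y) :=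
  (((HasD.snd l).sub ((hasD_randersExample ha hx hy).mul (hasD_drift l))).div
    (hasD_rad ha hx hy) (rad_pos hx hy).ne').congr_deriv fun ξ ζ => by
      rw [dGrad, grad]; ring

/-- The components `F_{.j.k} = (δ_jk - F_{.j} W_k - F_{.k} W_j - λ F_{.j} F_{.k}) / A`. -/
def hess (a : Coord n) (j k : Fin n) : Scal n := fun x y =>
  ((if j = k then 1 else 0) - grad a j x y * drift a x k - grad a k x y * drift a x j
    - lam x * grad a j x y * grad a k x y) / rad a x y

/-- The components `η_l = A_{.l} / A`. -/
def eta (a : Coord n) (l : Fin n) : Scal n := fun x y =>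
  (lam x * grad a l x y + drift a x l) / rad a x y

/-- The gradient formula solved for `y_l`. Eliminating `y_l` in favour of `F_{.l}` leaves no hidden
relation between the remaining components, so that `ring` can finish. -/
theorem snd_eq (hx : x ⬝ᵥ x < 1) (hy : y ≠ 0) (l : Fin n) :
    y l = rad a x y * grad a l x y + 𝓕 a x y * drift a x l := by
  rw [grad, mul_div_cancel₀ _ (rad_pos hx hy).ne']
  ring

theorem dDrift0_single (k : Fin n) : dDrift0 a x y 0 (Pi.single k 1) = drift a x k := by
  simp [dDrift0, drift]

theorem dRanders_single (k : Fin n) : dRanders a x y 0 (Pi.single k 1) = grad a k x y := by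
  simp [dRanders, grad, dDrift0_single]

theorem dRad_single (hx : x ⬝ᵥ x < 1) (hy : y ≠ 0) (k : Fin n) :
    dRad a x y 0 (Pi.single k 1) = rad a x y * eta a k x y := by
  rw [eta, mul_div_cancel₀ _ (rad_pos hx hy).ne']
  simp [dRad, dRanders_single, dDrift0_single]

theorem dGrad_single (hx : x ⬝ᵥ x < 1) (hy : y ≠ 0) (l k : Fin n) :
    dGrad a l x y 0 (Pi.single k 1) = hess a l k x y := by
  have := (rad_pos (a := a) hx hy).ne'
  rw [dGrad, hess, dRad_single hx hy, eta, dRanders_single, Pi.single_apply]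
  simp only [dotProduct_zero, Pi.zero_apply]
  field_simp
  ring

theorem hess_symm (j k : Fin n) : hess a j k x y = hess a k j x y := by
  simp only [hess, eq_comm (a := j)]
  ring

end

/-! ### Closed forms of the spray and of the connection -/

/-- `q_i = -((|x|² - 2 ⟨a, x⟩²) x_i + |x|² ⟨a, x⟩ a_i)`. -/
def quad (a x : Coord n) (i : Fin n) : ℝ :=
  -((x ⬝ᵥ x - 2 * (a ⬝ᵥ x) ^ 2) * x i + (x ⬝ᵥ x) * (a ⬝ᵥ x) * a i)

/-- `p_i = 2 (x_i ⟨a, y⟩ - a_i ⟨x, y⟩)`. -/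
def twist (a x y : Coord n) (i : Fin n) : ℝ := 2 * (x i * (a ⬝ᵥ y) - a i * (x ⬝ᵥ y))

/-- The closed form `G = F p + F² q + ⟨a, x⟩ F y` of the spray coefficients. -/
def sprayVec (a x y : Coord n) (i : Fin n) : ℝ :=
  𝓕 a x y * twist a x y i + 𝓕 a x y ^ 2 * quad a x i + (a ⬝ᵥ x) * 𝓕 a x y * y i

/-- `V = p + ⟨a, x⟩ y + 2 F q`. -/
def vel (a x y : Coord n) (i : Fin n) : ℝ :=
  twist a x y i + (a ⬝ᵥ x) * y i + 2 * 𝓕 a x y * quad a x i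

/-- The closed form of the connection coefficients `Nⁱ_l`. -/
def conn (a x y : Coord n) (i l : Fin n) : ℝ :=
  grad a l x y * vel a x y i
    + 𝓕 a x y * (2 * (x i * a l - a i * x l) + if i = l then a ⬝ᵥ x else 0)

/-- `w_l = a_l ⟨x, y⟩ - x_l ⟨a, y⟩ - F q_l`. -/
def cross (a x y : Coord n) (l : Fin n) : ℝ :=
  a l * (x ⬝ᵥ y) - x l * (a ⬝ᵥ y) - 𝓕 a x y * quad a x l

/-- The closed form of `∂F/∂xˡ`. -/
def horGrad (a x y : Coord n) (l : Fin n) : ℝ :=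
  2 * (a ⬝ᵥ x) * 𝓕 a x y * grad a l x y + 2 * 𝓕 a x y * cross a x y l / rad a x y

section

variable {a x y : Coord n}

theorem dotProduct_quad (t : Coord n) : t ⬝ᵥ quad a x =
    -((x ⬝ᵥ x - 2 * (a ⬝ᵥ x) ^ 2) * (t ⬝ᵥ x) + (x ⬝ᵥ x) * (a ⬝ᵥ x) * (t ⬝ᵥ a)) := by
  have : quad a x = (-(x ⬝ᵥ x - 2 * (a ⬝ᵥ x) ^ 2)) • x - ((x ⬝ᵥ x) * (a ⬝ᵥ x)) • a := by
    ext i; simp [quad]; ring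
  rw [this, dotProduct_sub, dotProduct_smul, dotProduct_smul]
  simp only [smul_eq_mul]; ring

theorem dotProduct_twist (t : Coord n) : t ⬝ᵥ twist a x y =
    2 * ((t ⬝ᵥ x) * (a ⬝ᵥ y) - (t ⬝ᵥ a) * (x ⬝ᵥ y)) := by
  have : twist a x y = (2 * (a ⬝ᵥ y)) • x - (2 * (x ⬝ᵥ y)) • a := by
    ext i; simp [twist]; ring
  rw [this, dotProduct_sub, dotProduct_smul, dotProduct_smul]
  simp only [smul_eq_mul]; ring

theorem dotProduct_vel (t : Coord n) : t ⬝ᵥ vel a x y =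
    t ⬝ᵥ twist a x y + (a ⬝ᵥ x) * (t ⬝ᵥ y) + 2 * 𝓕 a x y * (t ⬝ᵥ quad a x) := by
  have : vel a x y = twist a x y + (a ⬝ᵥ x) • y + (2 * 𝓕 a x y) • quad a x := by
    ext i; simp [vel]
  rw [this, dotProduct_add, dotProduct_add, dotProduct_smul, dotProduct_smul]
  simp only [smul_eq_mul]

theorem dotProduct_sprayVec (t : Coord n) : t ⬝ᵥ sprayVec a x y =
    𝓕 a x y * (t ⬝ᵥ twist a x y) + 𝓕 a x y ^ 2 * (t ⬝ᵥ quad a x)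
      + (a ⬝ᵥ x) * 𝓕 a x y * (t ⬝ᵥ y) := by
  have : sprayVec a x y = 𝓕 a x y • twist a x y + 𝓕 a x y ^ 2 • quad a x
      + ((a ⬝ᵥ x) * 𝓕 a x y) • y := by
    ext i; simp [sprayVec]
  rw [this, dotProduct_add, dotProduct_add, dotProduct_smul, dotProduct_smul, dotProduct_smul]
  simp only [smul_eq_mul]

theorem grad_dotProduct (t : Coord n) :
    (fun l => grad a l x y) ⬝ᵥ t = (y ⬝ᵥ t - 𝓕 a x y * (drift a x ⬝ᵥ t)) / rad a x y := by
  have : (fun l => grad a l x y) = (rad a x y)⁻¹ • (y - 𝓕 a x y • drift a x) := by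
    ext i; simp [grad]; ring
  rw [this, smul_dotProduct, sub_dotProduct, smul_dotProduct]
  simp only [smul_eq_mul]; ring

theorem sum_mul_conn (t : Coord n) (l : Fin n) : ∑ r, t r * conn a x y r l =
    grad a l x y * (t ⬝ᵥ vel a x y)
      + 𝓕 a x y * (2 * ((t ⬝ᵥ x) * a l - (t ⬝ᵥ a) * x l) + (a ⬝ᵥ x) * t l) := by
  have : ∀ r, t r * conn a x y r l = grad a l x y * (t r * vel a x y r)
      + 𝓕 a x y * (2 * ((t r * x r) * a l - (t r * a r) * x l)
        + if r = l then (a ⬝ᵥ x) * t r else 0) := fun r => by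
    simp only [conn]; split_ifs <;> ring
  simp only [this, Finset.sum_add_distrib, ← Finset.mul_sum, Finset.sum_sub_distrib,
    ← Finset.sum_mul, Finset.sum_ite_eq', Finset.mem_univ, if_true]
  rfl

theorem sum_conn_mul (t : Coord n) (i : Fin n) : ∑ l, conn a x y i l * t l =
    ((fun l => grad a l x y) ⬝ᵥ t) * vel a x y i
      + 𝓕 a x y * (2 * (x i * (a ⬝ᵥ t) - a i * (x ⬝ᵥ t)) + (a ⬝ᵥ x) * t i) := by
  have : ∀ l, conn a x y i l * t l = grad a l x y * t l * vel a x y i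
      + 𝓕 a x y * (2 * (x i * (a l * t l) - a i * (x l * t l))
        + if i = l then (a ⬝ᵥ x) * t l else 0) := fun l => by
    simp only [conn]; split_ifs <;> ring
  simp only [this, Finset.sum_add_distrib, ← Finset.mul_sum, Finset.sum_sub_distrib,
    ← Finset.sum_mul, Finset.sum_ite_eq, Finset.mem_univ, if_true]
  rfl

theorem dRanders_horizontal (hx : x ⬝ᵥ x < 1) (hy : y ≠ 0) (l : Fin n) :
    dRanders a x y (Pi.single l 1) 0 = horGrad a x y l := by
  have hr := rad_pos (a := a) hx hy
  simp only [dRanders, dDrift0, horGrad, dotProduct_zero, dotProduct_single_one, cross, quad]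
  rw [snd_eq (a := a) hx hy l, drift]
  field_simp
  ring

theorem drift_dotProduct_vel (ha : a ⬝ᵥ a = 1) : drift a x ⬝ᵥ vel a x y =
    2 * (y ⬝ᵥ quad a x) + (a ⬝ᵥ x) * drift0 a x y := by
  simp only [drift_dotProduct, drift0, dotProduct_vel, dotProduct_twist, dotProduct_quad,
    dotProduct_comm x a, dotProduct_comm y x, dotProduct_comm y a, ha]
  ring

theorem grad_dotProduct_vel (ha : a ⬝ᵥ a = 1) (hx : x ⬝ᵥ x < 1) (hy : y ≠ 0) :
    (fun l => grad a l x y) ⬝ᵥ vel a x y = (a ⬝ᵥ x) * 𝓕 a x y := by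
  have hr := rad_pos (a := a) hx hy
  rw [grad_dotProduct, drift_dotProduct_vel ha, div_eq_iff hr.ne', rad_eq ha hx]
  simp only [drift0, dotProduct_vel, dotProduct_twist, dotProduct_quad,
    dotProduct_comm y x, dotProduct_comm y a, quadratic_eq (y := y) ha hx]
  ring

/-- This is `F_{|l} = 0`: the metric is constant along horizontal directions. -/
theorem sum_grad_mul_conn (ha : a ⬝ᵥ a = 1) (hx : x ⬝ᵥ x < 1) (hy : y ≠ 0) (l : Fin n) :
    ∑ r, grad a r x y * conn a x y r l = horGrad a x y l := by
  have hr := rad_pos (a := a) hx hy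
  rw [sum_mul_conn (fun r => grad a r x y), grad_dotProduct_vel ha hx hy, horGrad, grad_dotProduct,
    grad_dotProduct, drift_dotProduct, drift_dotProduct]
  simp only [drift0, dotProduct_comm y x, dotProduct_comm y a, dotProduct_comm x a, ha, cross,
    quad]
  field_simp
  ring

theorem sum_drift_mul_conn (ha : a ⬝ᵥ a = 1) (l : Fin n) :
    ∑ r, drift a x r * conn a x y r l =
      grad a l x y * (2 * (y ⬝ᵥ quad a x) + (a ⬝ᵥ x) * drift0 a x y)
        + 𝓕 a x y * (2 * quad a x l + (a ⬝ᵥ x) * drift a x l) := by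
  rw [sum_mul_conn, drift_dotProduct_vel ha, drift_dotProduct, drift_dotProduct]
  simp only [drift0, dotProduct_comm x a, ha, quad, drift]
  ring

/-! ### Derivatives along the spray -/

/-- The vertical part `-2 G` of the spray. -/
def flowVec (a x y : Coord n) : Coord n := fun i => -2 * sprayVec a x y i

theorem dotProduct_flowVec (t : Coord n) : t ⬝ᵥ flowVec a x y = -2 * (t ⬝ᵥ sprayVec a x y) := by
  have : flowVec a x y = (-2 : ℝ) • sprayVec a x y := rfl
  rw [this, dotProduct_smul, smul_eq_mul]

theorem dDrift0_flow (ha : a ⬝ᵥ a = 1) (hx : x ⬝ᵥ x < 1) : dDrift0 a x y y (flowVec a x y) =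
    -2 * (a ⬝ᵥ x) * 𝓕 a x y * rad a x y + 4 * (x ⬝ᵥ x) * (x ⬝ᵥ y) * 𝓕 a x y := by
  simp only [dDrift0, dotProduct_flowVec, dotProduct_sprayVec, dotProduct_twist, dotProduct_quad,
    dotProduct_comm x a, ha, quadratic_eq (y := y) ha hx, rad_eq (y := y) ha hx]
  simp only [drift0, lam]
  ring

/-- Conservation of `F` along the candidate spray `sprayVec`. Together with `dGrad_flow`, the
Euler–Lagrange equation, it serves to identify `sprayVec` with the true spray. -/
theorem dRanders_flow (ha : a ⬝ᵥ a = 1) (hx : x ⬝ᵥ x < 1) :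
    dRanders a x y y (flowVec a x y) = 0 := by
  rw [dRanders, dDrift0_flow ha hx, dotProduct_flowVec, dotProduct_sprayVec, dotProduct_twist,
    dotProduct_quad, quadratic_eq (y := y) ha hx, rad_eq (y := y) ha hx]
  simp only [drift0, lam, dotProduct_comm y x, dotProduct_comm y a]
  ring

theorem dRad_flow (ha : a ⬝ᵥ a = 1) (hx : x ⬝ᵥ x < 1) :
    dRad a x y y (flowVec a x y) = -2 * (a ⬝ᵥ x) * 𝓕 a x y * rad a x y := by
  rw [dRad, dRanders_flow ha hx, dDrift0_flow ha hx]
  ring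

theorem dGrad_flow (ha : a ⬝ᵥ a = 1) (hx : x ⬝ᵥ x < 1) (hy : y ≠ 0) (l : Fin n) :
    dGrad a l x y y (flowVec a x y) = horGrad a x y l := by
  have hr := rad_pos (a := a) hx hy
  simp only [dGrad, dRanders_flow ha hx, dRad_flow ha hx, horGrad, flowVec, sprayVec, twist,
    cross]
  field_simp
  rw [snd_eq (a := a) hx hy l, drift]
  ring

/-- The differential of `F_{.j.k}`. -/
def dHess (a : Coord n) (j k : Fin n) (x y ξ ζ : Coord n) : ℝ :=
  (-dGrad a j x y ξ ζ * (drift a x k + lam x * grad a k x y)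
    - dGrad a k x y ξ ζ * (drift a x j + lam x * grad a j x y)
    - grad a j x y * (2 * (x ⬝ᵥ ξ) * a k - 2 * (a ⬝ᵥ ξ) * x k - 2 * (a ⬝ᵥ x) * ξ k)
    - grad a k x y * (2 * (x ⬝ᵥ ξ) * a j - 2 * (a ⬝ᵥ ξ) * x j - 2 * (a ⬝ᵥ x) * ξ j)
    + 4 * (x ⬝ᵥ x) * (x ⬝ᵥ ξ) * grad a j x y * grad a k x y
    - hess a j k x y * dRad a x y ξ ζ) / rad a x y

theorem hasD_hess (ha : a ⬝ᵥ a = 1) (hx : x ⬝ᵥ x < 1) (hy : y ≠ 0) (j k : Fin n) :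
    HasD (hess a j k) x y (dHess a j k x y) :=
  (((((HasD.const _).sub ((hasD_grad ha hx hy j).mul (hasD_drift k))).sub
    ((hasD_grad ha hx hy k).mul (hasD_drift j))).sub
    ((hasD_lam.mul (hasD_grad ha hx hy j)).mul (hasD_grad ha hx hy k))).div
    (hasD_rad ha hx hy) (rad_pos hx hy).ne').congr_deriv fun ξ ζ => by
      rw [dHess, hess]; ring

/-- Since `F_{.j.k}` has denominator `A`, a vertical derivative produces the logarithmic derivative
`η` of `A`; total symmetry of the third derivative supplies the other two terms. This formula makes
the Douglas curvature a symmetrized product. -/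
theorem dHess_single (hx : x ⬝ᵥ x < 1) (hy : y ≠ 0) (j k l : Fin n) :
    dHess a j k x y 0 (Pi.single l 1) =
      -(eta a l x y * hess a j k x y + eta a j x y * hess a k l x y
        + eta a k x y * hess a l j x y) := by
  have hr := rad_pos (a := a) hx hy
  simp only [dHess, dGrad_single hx hy, dRad_single hx hy, dotProduct_zero, Pi.zero_apply,
    hess_symm l j]
  rw [show eta a j x y = (lam x * grad a j x y + drift a x j) / rad a x y from rfl,
    show eta a k x y = (lam x * grad a k x y + drift a x k) / rad a x y from rfl]
  field_simp
  ring

theorem sum_conn_mul_hess (ha : a ⬝ᵥ a = 1) (hx : x ⬝ᵥ x < 1) (hy : y ≠ 0) (j k : Fin n) :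
    ∑ r, conn a x y r j * hess a r k x y =
      (conn a x y k j - horGrad a x y j * drift a x k
        - grad a k x y * (∑ r, drift a x r * conn a x y r j)
        - lam x * grad a k x y * horGrad a x y j) / rad a x y := by
  have h : ∀ r, conn a x y r j * hess a r k x y =
      ((if r = k then conn a x y r j else 0) - grad a r x y * conn a x y r j * drift a x k
        - grad a k x y * (drift a x r * conn a x y r j)
        - lam x * grad a k x y * (grad a r x y * conn a x y r j)) / rad a x y := fun r => by
    rw [hess]; split_ifs <;> ring
  simp only [h, ← Finset.sum_div, Finset.sum_sub_distrib, ← Finset.mul_sum, ← Finset.sum_mul,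
    sum_grad_mul_conn ha hx hy, Finset.sum_ite_eq', Finset.mem_univ, if_true]

/-- This is `F_{.j.k|0} = 0`, which holds for every Finsler metric; here it is checked on the closed
forms. -/
theorem dHess_flow (ha : a ⬝ᵥ a = 1) (hx : x ⬝ᵥ x < 1) (hy : y ≠ 0) (j k : Fin n) :
    dHess a j k x y y (flowVec a x y) =
      ∑ r, conn a x y r j * hess a r k x y + ∑ r, conn a x y r k * hess a j r x y := by
  have hr := rad_pos (a := a) hx hy
  simp only [hess_symm j]
  rw [sum_conn_mul_hess ha hx hy, sum_conn_mul_hess ha hx hy, dHess, sum_drift_mul_conn ha,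
    sum_drift_mul_conn ha, dGrad_flow ha hx hy, dGrad_flow ha hx hy, dRad_flow ha hx, hess,
    conn, conn, vel, vel, snd_eq (a := a) hx hy j, snd_eq (a := a) hx hy k]
  have hA := rad_eq (y := y) ha hx
  simp only [eq_comm (a := k), twist, quad, drift, dotProduct_comm y x, dotProduct_comm y a,
    dotProduct_quad]
  generalize horGrad a x y j = hj
  generalize horGrad a x y k = hk
  simp only [drift0] at hA ⊢
  generalize rad a x y = A at *
  rw [← add_div]
  congr 1
  split_ifs
  · field_simp
    simp only [hA, lam]
    ring
  · field_simp
    simp only [hA, lam]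
    ring

/-- The differential of `η_l`. -/
def dEta (a : Coord n) (l : Fin n) (x y ξ ζ : Coord n) : ℝ :=
  (-4 * (x ⬝ᵥ x) * (x ⬝ᵥ ξ) * grad a l x y + lam x * dGrad a l x y ξ ζ
    + (2 * (x ⬝ᵥ ξ) * a l - 2 * (a ⬝ᵥ ξ) * x l - 2 * (a ⬝ᵥ x) * ξ l)
    - eta a l x y * dRad a x y ξ ζ) / rad a x y

theorem hasD_eta (ha : a ⬝ᵥ a = 1) (hx : x ⬝ᵥ x < 1) (hy : y ≠ 0) (l : Fin n) :
    HasD (eta a l) x y (dEta a l x y) :=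
  (((hasD_lam.mul (hasD_grad ha hx hy l)).add (hasD_drift l)).div
    (hasD_rad ha hx hy) (rad_pos hx hy).ne').congr_deriv fun ξ ζ => by
      rw [dEta, eta]

theorem sum_eta_mul_conn (ha : a ⬝ᵥ a = 1) (hx : x ⬝ᵥ x < 1) (hy : y ≠ 0) (l : Fin n) :
    ∑ r, eta a r x y * conn a x y r l =
      (lam x * horGrad a x y l + ∑ r, drift a x r * conn a x y r l) / rad a x y := by
  have h : ∀ r, eta a r x y * conn a x y r l = (lam x * (grad a r x y * conn a x y r l)
      + drift a x r * conn a x y r l) / rad a x y := fun r => by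
    rw [eta]; ring
  simp only [h, ← Finset.sum_div, Finset.sum_add_distrib, ← Finset.mul_sum,
    sum_grad_mul_conn ha hx hy]

/-- `e_l = F_{.l} ⟨q, y⟩ + w_l`. -/
def skew (a x y : Coord n) (l : Fin n) : ℝ :=
  grad a l x y * (y ⬝ᵥ quad a x) + cross a x y l

/-- The terms other than the connection sum are `η_{l|0}`. -/
theorem dEta_flow (ha : a ⬝ᵥ a = 1) (hx : x ⬝ᵥ x < 1) (hy : y ≠ 0) (l : Fin n) :
    dEta a l x y y (flowVec a x y) = ∑ r, eta a r x y * conn a x y r l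
      + (a ⬝ᵥ x) * (grad a l x y - 𝓕 a x y * eta a l x y)
      + 2 * skew a x y l / rad a x y := by
  have hr := rad_pos (a := a) hx hy
  rw [sum_eta_mul_conn ha hx hy, dEta, dGrad_flow ha hx hy, dRad_flow ha hx,
    sum_drift_mul_conn ha, skew, eta, cross]
  simp only [dotProduct_quad, quad, dotProduct_comm y x, dotProduct_comm y a]
  field_simp
  rw [snd_eq (a := a) hx hy l, rad_eq ha hx]
  simp only [drift, drift0, lam]
  ring

end

/-! ### Positivity of the fundamental tensor, the spray, and the Finsler and Randers properties -/

section

variable {a x y : Coord n}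

theorem hasD_randersExample_sq (ha : a ⬝ᵥ a = 1) (hx : x ⬝ᵥ x < 1) (hy : y ≠ 0) :
    HasD (fun x y => 𝓕 a x y ^ 2) x y (fun ξ ζ => 2 * 𝓕 a x y * dRanders a x y ξ ζ) :=
  (hasD_randersExample ha hx hy).sq

theorem hasD_dy_randersExample_sq (ha : a ⬝ᵥ a = 1) (hx : x ⬝ᵥ x < 1) (hy : y ≠ 0) (l : Fin n) :
    HasD (dy l fun x y => 𝓕 a x y ^ 2) x y (fun ξ ζ =>
      2 * (dRanders a x y ξ ζ * grad a l x y + 𝓕 a x y * dGrad a l x y ξ ζ)) := by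
  refine HasD.congr_fun isOpen_unitBall (((hasD_randersExample ha hx hy).mul
    (hasD_grad ha hx hy l)).const_mul 2) hx hy fun x hx y hy => ?_
  rw [(hasD_randersExample_sq ha hx hy).dy_eq, dRanders_single, mul_assoc]

theorem fundTensor_apply (ha : a ⬝ᵥ a = 1) (hx : x ⬝ᵥ x < 1) (hy : y ≠ 0) (i j : Fin n) :
    fundTensor (𝓕 a) x y i j =
      grad a i x y * grad a j x y + 𝓕 a x y * hess a i j x y := by
  rw [fundTensor, Matrix.of_apply, (hasD_dy_randersExample_sq ha hx hy j).dy_eq,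
    dRanders_single, dGrad_single hx hy, hess_symm j i]
  ring

theorem rad_mul_fundTensor_apply (ha : a ⬝ᵥ a = 1) (hx : x ⬝ᵥ x < 1) (hy : y ≠ 0) (i j : Fin n) :
    rad a x y * fundTensor (𝓕 a) x y i j =
      𝓕 a x y * (if i = j then 1 else 0) + drift0 a x y * grad a i x y * grad a j x y
        - 𝓕 a x y * (grad a i x y * drift a x j + drift a x i * grad a j x y) := by
  have hr := rad_pos (a := a) hx hy
  rw [fundTensor_apply ha hx hy, hess]
  field_simp
  rw [rad_eq ha hx]
  ring

/-- A sum of squares exhibiting positivity: if `F_{.l}vˡ = 0`, the last term is `F²|v|²`, and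
otherwise the first term is positive. -/
theorem rad_mul_fundTensor (ha : a ⬝ᵥ a = 1) (hx : x ⬝ᵥ x < 1) (hy : y ≠ 0) (v : Coord n) :
    𝓕 a x y * rad a x y * (v ⬝ᵥ (fundTensor (𝓕 a) x y *ᵥ v)) =
      𝓕 a x y * rad a x y * ((fun l => grad a l x y) ⬝ᵥ v) ^ 2 +
        (𝓕 a x y • v - ((fun l => grad a l x y) ⬝ᵥ v) • y) ⬝ᵥ
          (𝓕 a x y • v - ((fun l => grad a l x y) ⬝ᵥ v) • y) := by
  have hr := rad_pos (a := a) hx hy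
  set f : Coord n := fun l => grad a l x y with hf
  have h1 : rad a x y • (fundTensor (𝓕 a) x y *ᵥ v) =
      𝓕 a x y • v + (drift0 a x y * (f ⬝ᵥ v) - 𝓕 a x y * (drift a x ⬝ᵥ v)) • f
        - (𝓕 a x y * (f ⬝ᵥ v)) • drift a x := by
    ext i
    simp only [Matrix.mulVec, Pi.smul_apply, smul_eq_mul, Pi.add_apply, Pi.sub_apply]
    simp only [dotProduct, Finset.mul_sum, ← mul_assoc, rad_mul_fundTensor_apply ha hx hy]
    have : ∀ j, (𝓕 a x y * (if i = j then 1 else 0) + drift0 a x y * grad a i x y * grad a j x y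
        - 𝓕 a x y * (grad a i x y * drift a x j + drift a x i * grad a j x y)) * v j =
        (if i = j then 𝓕 a x y * v j else 0) + drift0 a x y * f j * v j * f i
        - 𝓕 a x y * drift a x j * v j * f i - 𝓕 a x y * f j * v j * drift a x i := fun j => by
      simp only [hf]; split_ifs <;> ring
    simp only [this, Finset.sum_add_distrib, Finset.sum_sub_distrib, ← Finset.sum_mul,
      Finset.sum_ite_eq, Finset.mem_univ, if_true]
    ring
  have h2 : v ⬝ᵥ (rad a x y • (fundTensor (𝓕 a) x y *ᵥ v)) =
      rad a x y * (v ⬝ᵥ (fundTensor (𝓕 a) x y *ᵥ v)) := by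
    rw [dotProduct_smul, smul_eq_mul]
  have h3 : rad a x y * (f ⬝ᵥ v) = y ⬝ᵥ v - 𝓕 a x y * (drift a x ⬝ᵥ v) := by
    rw [hf, grad_dotProduct, mul_div_cancel₀ _ hr.ne']
  rw [mul_assoc, ← h2, h1]
  simp only [dotProduct_add, dotProduct_sub, dotProduct_smul, smul_dotProduct, sub_dotProduct,
    smul_eq_mul, dotProduct_comm v f, dotProduct_comm v y, dotProduct_comm v (drift a x),
    quadratic_eq (y := y) ha hx]
  have hA := rad_eq (y := y) ha hx
  generalize f ⬝ᵥ v = t at *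
  generalize drift a x ⬝ᵥ v = s at *
  generalize rad a x y = A at *
  subst hA
  linear_combination (-2 * 𝓕 a x y * t) * h3

theorem fundTensor_posDef (ha : a ⬝ᵥ a = 1) (hx : x ⬝ᵥ x < 1) (hy : y ≠ 0) :
    (fundTensor (𝓕 a) x y).PosDef := by
  have hr := rad_pos (a := a) hx hy
  have hF := randersExample_pos ha hx hy
  refine Matrix.PosDef.of_dotProduct_mulVec_pos (Matrix.IsHermitian.ext fun i j => ?_)
    fun v hv => ?_
  · simp only [fundTensor_apply ha hx hy, star_trivial, hess_symm j i, mul_comm]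
  · rw [star_trivial]
    refine pos_of_mul_pos_right (a := 𝓕 a x y * rad a x y) ?_ (mul_pos hF hr).le
    rw [rad_mul_fundTensor ha hx hy]
    by_cases h : (fun l => grad a l x y) ⬝ᵥ v = 0
    · rw [h]
      have := dotProduct_self_pos' hv
      simp
      positivity
    · refine add_pos_of_pos_of_nonneg ?_ (dot_self_nonneg _)
      positivity

/-- The Euler–Lagrange equations say that `g` applied to `sprayVec` is the covector defining the
spray; `g` is invertible because it is positive definite. -/
theorem spray_randersExample (ha : a ⬝ᵥ a = 1) (hx : x ⬝ᵥ x < 1) (hy : y ≠ 0) (i : Fin n) :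
    spray (𝓕 a) i x y = sprayVec a x y i := by
  have h1 : ∀ l, ∑ k, dx k (dy l (fun x y => 𝓕 a x y ^ 2)) x y * y k
      - dx l (fun x y => 𝓕 a x y ^ 2) x y =
      4 * (fundTensor (𝓕 a) x y *ᵥ sprayVec a x y) l := fun l => by
    have hd := (hasD_dy_randersExample_sq ha hx hy l).apply_eq_sum y (flowVec a x y)
    rw [dRanders_flow ha hx, dGrad_flow ha hx hy] at hd
    have hg : ∀ i, dy i (dy l fun x y => 𝓕 a x y ^ 2) x y = 2 * fundTensor (𝓕 a) x y l i :=
      fun i => by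
        rw [(hasD_dy_randersExample_sq ha hx hy l).dy_eq, fundTensor_apply ha hx hy,
          dRanders_single, dGrad_single hx hy]
        ring
    rw [(hasD_randersExample_sq ha hx hy).dx_eq, dRanders_horizontal hx hy]
    simp only [hg, flowVec] at hd
    simp only [Matrix.mulVec, dotProduct, mul_comm _ (y _), Finset.mul_sum]
    have : ∑ m, -2 * sprayVec a x y m * (2 * fundTensor (𝓕 a) x y l m) =
      - ∑ i, 4 * (fundTensor (𝓕 a) x y l i * sprayVec a x y i) := by
      rw [← Finset.sum_neg_distrib]
      exact Finset.sum_congr rfl fun i _ => by ring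
    rw [this] at hd
    linarith
  have hu : IsUnit (fundTensor (𝓕 a) x y).det :=
    (fundTensor_posDef ha hx hy).det_pos.ne'.isUnit
  have h2 : ((fundTensor (𝓕 a) x y)⁻¹ *ᵥ (fundTensor (𝓕 a) x y *ᵥ sprayVec a x y)) i =
      sprayVec a x y i := by
    rw [Matrix.mulVec_mulVec, Matrix.nonsing_inv_mul _ hu, Matrix.one_mulVec]
  simp only [spray, h1]
  rw [← h2]
  simp only [Matrix.mulVec, dotProduct, Finset.mul_sum]
  exact Finset.sum_congr rfl fun l _ => by ring_nf

theorem randersExample_zero (a x : Coord n) : 𝓕 a x 0 = 0 := by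
  simp [randersExample]

theorem contDiffOn_randersExample (ha : a ⬝ᵥ a = 1) :
    ContDiffOn ℝ ∞ (fun p : Coord n × Coord n => 𝓕 a p.1 p.2)
      ({x : Coord n | x ⬝ᵥ x < 1} ×ˢ {0}ᶜ) := by
  have hd : ∀ f g : Coord n × Coord n → Coord n, ContDiff ℝ ∞ f → ContDiff ℝ ∞ g →
      ContDiff ℝ ∞ fun p => f p ⬝ᵥ g p := fun f g hf hg => by
    rw [contDiff_pi] at hf hg
    exact ContDiff.sum fun i _ => (hf i).mul (hg i)
  have h0 : ContDiff ℝ ∞ fun p : Coord n × Coord n => drift0 a p.1 p.2 :=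
    ((hd _ _ contDiff_fst contDiff_fst).mul (hd _ _ contDiff_const contDiff_snd)).sub
      ((contDiff_const.mul (hd _ _ contDiff_const contDiff_fst)).mul
        (hd _ _ contDiff_fst contDiff_snd))
  have hl : ContDiff ℝ ∞ fun p : Coord n × Coord n => lam p.1 :=
    contDiff_const.sub ((hd _ _ contDiff_fst contDiff_fst).pow 2)
  simp only [randersExample_eq ha]
  refine ContDiffOn.div (ContDiffOn.sub (ContDiffOn.sqrt ?_ ?_) h0.contDiffOn) hl.contDiffOn ?_
  · exact ((hl.mul (hd _ _ contDiff_snd contDiff_snd)).add (h0.pow 2)).contDiffOn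
  · exact fun p hp => (rad_sq_pos hp.1 hp.2).ne'
  · exact fun p hp => (lam_pos hp.1).ne'

theorem randersExample_smul (ha : a ⬝ᵥ a = 1) {t : ℝ} (ht : 0 < t) :
    𝓕 a x (t • y) = t * 𝓕 a x y := by
  have h0 : drift0 a x (t • y) = t * drift0 a x y := by
    simp only [drift0, dotProduct_smul, smul_eq_mul]; ring
  rw [randersExample_eq ha, randersExample_eq ha, h0, rad, rad, h0, dotProduct_smul,
    smul_dotProduct, smul_eq_mul, smul_eq_mul,
    show lam x * (t * (t * (y ⬝ᵥ y))) + (t * drift0 a x y) ^ 2 =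
      t ^ 2 * (lam x * (y ⬝ᵥ y) + drift0 a x y ^ 2) by ring,
    Real.sqrt_mul (sq_nonneg t), Real.sqrt_sq ht.le]
  ring

theorem isFinslerMetric_randersExample (ha : a ⬝ᵥ a = 1) :
    IsFinslerMetric {x : Coord n | x ⬝ᵥ x < 1} (𝓕 a) where
  isOpen := isOpen_unitBall
  nonneg x hx y := by
    rcases eq_or_ne y 0 with rfl | hy
    · rw [randersExample_zero]
    · exact (randersExample_pos ha hx hy).le
  smooth := contDiffOn_randersExample ha
  homogeneous x hx y t ht := randersExample_smul ha ht
  posDef x hx y hy := fundTensor_posDef ha hx hy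

theorem isRandersMetric_randersExample (ha : a ⬝ᵥ a = 1) :
    IsRandersMetric {x : Coord n | x ⬝ᵥ x < 1} (𝓕 a) := by
  have hs : ContDiff ℝ ∞ fun x : Coord n => x ⬝ᵥ x :=
    ContDiff.sum fun i _ => (contDiff_apply ℝ ℝ i).mul (contDiff_apply ℝ ℝ i)
  have hc : ContDiff ℝ ∞ fun x : Coord n => a ⬝ᵥ x :=
    ContDiff.sum fun i _ => contDiff_const.mul (contDiff_apply ℝ ℝ i)
  have hW : ∀ i, ContDiff ℝ ∞ fun x : Coord n => drift a x i := fun i =>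
    (hs.mul contDiff_const).sub ((contDiff_const.mul hc).mul (contDiff_apply ℝ ℝ i))
  have hl : ContDiff ℝ ∞ fun x : Coord n => lam x := contDiff_const.sub (hs.pow 2)
  -- From `α² = (λ|y|² + W₀²)/λ²` and `β = -W₀/λ`.
  set g : Coord n → Matrix (Fin n) (Fin n) ℝ := fun x =>
    ((lam x) ^ 2)⁻¹ • (lam x • (1 : Matrix (Fin n) (Fin n) ℝ)
      + Matrix.vecMulVec (drift a x) (drift a x)) with hg
  have hmul : ∀ x v : Coord n, g x *ᵥ v =
      ((lam x) ^ 2)⁻¹ • (lam x • v + (drift a x ⬝ᵥ v) • drift a x) := fun x v => by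
    simp only [hg, Matrix.smul_mulVec, Matrix.add_mulVec, Matrix.one_mulVec,
      Matrix.vecMulVec_mulVec, op_smul_eq_smul]
  have hpos : ∀ x : Coord n, x ⬝ᵥ x < 1 → (g x).PosDef := fun x hx => by
    have hl := lam_pos hx
    refine Matrix.PosDef.of_dotProduct_mulVec_pos (Matrix.IsHermitian.ext fun i j => ?_)
      fun v hv => ?_
    · simp [hg, Matrix.vecMulVec, Matrix.one_apply, eq_comm (a := i), mul_comm]
    · have := dotProduct_self_pos' hv
      rw [star_trivial, hmul]
      simp only [dotProduct_smul, dotProduct_add, smul_eq_mul, dotProduct_comm v (drift a x)]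
      have := mul_self_nonneg (drift a x ⬝ᵥ v)
      positivity
  refine ⟨g, fun x => -(lam x)⁻¹ • drift a x, fun i j => ?_, fun i => ?_, fun x hx =>
    ⟨hpos x hx, ?_, fun y => ?_⟩⟩
  · refine ContDiffOn.mul (ContDiffOn.inv (hl.pow 2).contDiffOn fun x hx =>
      (pow_pos (lam_pos hx) 2).ne') (ContDiff.contDiffOn ?_)
    exact (hl.mul contDiff_const).add ((hW i).mul (hW j))
  · exact (ContDiffOn.inv hl.contDiffOn fun x hx => (lam_pos hx).ne').neg.mul (hW i).contDiffOn
  · have hl := lam_pos hx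
    have hWW := drift_dotProduct_self (x := x) ha
    -- `W` is an eigenvector of `g` with eigenvalue `(λ + |W|²)/λ² = 1/λ²`. Hence the squared
    -- `α`-norm of `β` is `|W|² = |x|⁴`.
    have h1 : -(lam x)⁻¹ • drift a x = g x *ᵥ (-lam x • drift a x) := by
      rw [hmul, dotProduct_smul, hWW, smul_smul, ← add_smul, smul_smul, smul_eq_mul]
      congr 1
      field_simp
      rw [lam]
      ring
    have h2 : (g x)⁻¹ *ᵥ (-(lam x)⁻¹ • drift a x) = -lam x • drift a x := by
      rw [h1, Matrix.mulVec_mulVec, Matrix.nonsing_inv_mul _ (hpos x hx).det_pos.ne'.isUnit,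
        Matrix.one_mulVec]
    rw [h2, dotProduct_smul, smul_dotProduct, hWW, smul_eq_mul, smul_eq_mul]
    field_simp
    rw [lam] at hl
    linarith
  · have hl := lam_pos hx
    have h1 : y ⬝ᵥ (g x *ᵥ y) = ((lam x) ^ 2)⁻¹ * (lam x * (y ⬝ᵥ y) + drift0 a x y ^ 2) := by
      rw [hmul]
      simp only [dotProduct_smul, dotProduct_add, smul_eq_mul, dotProduct_comm y (drift a x),
        drift_dotProduct]
      ring
    rw [h1, Real.sqrt_mul (by positivity), Real.sqrt_inv, Real.sqrt_sq hl.le, smul_dotProduct,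
      drift_dotProduct, randersExample_eq ha, rad, smul_eq_mul]
    field_simp
    ring

end

/-! ### The determinant of the fundamental tensor in dimension three -/

section

variable {a x y : Coord 3}

theorem det_rank_two (s b : ℝ) (f w : Coord 3) :
    (Matrix.of fun i j : Fin 3 => s * (if i = j then 1 else 0) + b * f i * f j
      - s * (f i * w j + w i * f j)).det =
      s ^ 3 + s ^ 2 * (b * (f ⬝ᵥ f) - 2 * s * (f ⬝ᵥ w))
        - s ^ 3 * ((f ⬝ᵥ f) * (w ⬝ᵥ w) - (f ⬝ᵥ w) ^ 2) := by
  simp [Matrix.det_fin_three, dotProduct, Fin.sum_univ_three]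
  ring

theorem det_fundTensor (ha : a ⬝ᵥ a = 1) (hx : x ⬝ᵥ x < 1) (hy : y ≠ 0) :
    (fundTensor (𝓕 a) x y).det = (𝓕 a x y / rad a x y) ^ 4 := by
  have hr := rad_pos (a := a) hx hy
  have h1 : rad a x y • fundTensor (𝓕 a) x y = Matrix.of fun i j : Fin 3 =>
      𝓕 a x y * (if i = j then 1 else 0) + drift0 a x y * grad a i x y * grad a j x y
        - 𝓕 a x y * (grad a i x y * drift a x j + drift a x i * grad a j x y) := by
    ext i j
    rw [Matrix.smul_apply, smul_eq_mul, rad_mul_fundTensor_apply ha hx hy, Matrix.of_apply]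
  have h2 := congrArg Matrix.det h1
  rw [Matrix.det_smul, Fintype.card_fin, det_rank_two _ _ (fun l => grad a l x y)] at h2
  have h3 : rad a x y * ((fun l => grad a l x y) ⬝ᵥ drift a x) =
      drift0 a x y - 𝓕 a x y * (x ⬝ᵥ x) ^ 2 := by
    rw [grad_dotProduct, mul_div_cancel₀ _ hr.ne', dotProduct_comm, drift_dotProduct,
      drift_dotProduct_self ha]
  -- The vector `A∇F = y - F W` has Euclidean length `F` by the navigation equation.
  have h4 : rad a x y ^ 2 * ((fun l => grad a l x y) ⬝ᵥ (fun l => grad a l x y)) =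
      𝓕 a x y ^ 2 := by
    have h5 : rad a x y • (fun l => grad a l x y) = y - 𝓕 a x y • drift a x := by
      ext l
      simp [grad, mul_div_cancel₀ _ hr.ne']
    have h6 : rad a x y ^ 2 * ((fun l => grad a l x y) ⬝ᵥ (fun l => grad a l x y)) =
        (rad a x y • (fun l => grad a l x y)) ⬝ᵥ (rad a x y • (fun l => grad a l x y)) := by
      rw [smul_dotProduct, dotProduct_smul, smul_eq_mul, smul_eq_mul]; ring
    rw [h6, h5]
    simp only [sub_dotProduct, dotProduct_sub, smul_dotProduct, dotProduct_smul, smul_eq_mul,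
      dotProduct_comm y (drift a x), drift_dotProduct, drift_dotProduct_self ha,
      quadratic_eq (y := y) ha hx, lam]
    ring
  rw [drift_dotProduct_self ha] at h2
  have hA := rad_eq (y := y) ha hx
  rw [div_pow, eq_div_iff (by positivity)]
  apply mul_left_cancel₀ (pow_ne_zero 2 hr.ne')
  -- Eliminating `⟨∇F, W⟩` and `|∇F|²` from `A⁵ det g` leaves `F³` times the left side.
  have key : rad a x y ^ 2 + drift0 a x y * 𝓕 a x y
      - 2 * rad a x y * (drift0 a x y - 𝓕 a x y * (x ⬝ᵥ x) ^ 2) - 𝓕 a x y ^ 2 * (x ⬝ᵥ x) ^ 2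
      + (drift0 a x y - 𝓕 a x y * (x ⬝ᵥ x) ^ 2) ^ 2 = rad a x y * 𝓕 a x y := by
    rw [hA, lam]; ring
  generalize (fun l => grad a l x y) ⬝ᵥ drift a x = t at *
  generalize (fun l => grad a l x y) ⬝ᵥ (fun l => grad a l x y) = s at *
  generalize (fundTensor (𝓕 a) x y).det = D at *
  clear hA
  generalize rad a x y = A at *
  generalize 𝓕 a x y = F at *
  generalize drift0 a x y = w at *
  generalize (x ⬝ᵥ x) ^ 2 = r at *
  linear_combination A ^ 3 * h2 + A * (F ^ 2 * w - F ^ 3 * r) * h4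
    + (-2 * F ^ 3 * A ^ 2 + F ^ 3 * A * (A * t + (w - F * r))) * h3 + A * F ^ 3 * key

end

/-! ### Riemann curvature and Weyl curvature -/

/-- The differential of `p_i`. -/
def dTwist (a : Coord n) (i : Fin n) (x y ξ ζ : Coord n) : ℝ :=
  2 * (ξ i * (a ⬝ᵥ y) + x i * (a ⬝ᵥ ζ) - a i * (y ⬝ᵥ ξ + x ⬝ᵥ ζ))

/-- The differential of `q_i`. -/
def dQuad (a : Coord n) (i : Fin n) (x ξ : Coord n) : ℝ :=
  -((2 * (x ⬝ᵥ ξ) - 4 * (a ⬝ᵥ x) * (a ⬝ᵥ ξ)) * x i + (x ⬝ᵥ x - 2 * (a ⬝ᵥ x) ^ 2) * ξ i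
    + (2 * (x ⬝ᵥ ξ) * (a ⬝ᵥ x) + (x ⬝ᵥ x) * (a ⬝ᵥ ξ)) * a i)

/-- The differential of `V_i`. -/
def dVel (a : Coord n) (i : Fin n) (x y ξ ζ : Coord n) : ℝ :=
  dTwist a i x y ξ ζ + (a ⬝ᵥ ξ) * y i + (a ⬝ᵥ x) * ζ i
    + 2 * dRanders a x y ξ ζ * quad a x i + 2 * 𝓕 a x y * dQuad a i x ξ

/-- The differential of `Gⁱ`. -/
def dSpray (a : Coord n) (i : Fin n) (x y ξ ζ : Coord n) : ℝ :=
  dRanders a x y ξ ζ * vel a x y i + 𝓕 a x y * (dTwist a i x y ξ ζ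
    + 𝓕 a x y * dQuad a i x ξ + (a ⬝ᵥ ξ) * y i + (a ⬝ᵥ x) * ζ i)

/-- The differential of `Nⁱ_l`. -/
def dConn (a : Coord n) (i l : Fin n) (x y ξ ζ : Coord n) : ℝ :=
  dGrad a l x y ξ ζ * vel a x y i + grad a l x y * dVel a i x y ξ ζ
    + dRanders a x y ξ ζ * (2 * (x i * a l - a i * x l) + if i = l then a ⬝ᵥ x else 0)
    + 𝓕 a x y * (2 * (ξ i * a l - a i * ξ l) + if i = l then a ⬝ᵥ ξ else 0)

section

variable {a x y : Coord n}

theorem hasD_twist (i : Fin n) : HasD (fun x y => twist a x y i) x y (dTwist a i x y) :=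
  ((((HasD.fst i).mul (HasD.dotProduct_const_snd a)).sub
    (HasD.dotProduct_fst_snd.const_mul (a i))).const_mul 2).congr_deriv fun ξ ζ => by
      rw [dTwist]

theorem hasD_quad (i : Fin n) : HasD (fun x _ => quad a x i) x y (fun ξ _ => dQuad a i x ξ) :=
  ((((HasD.dotProduct_fst_self.sub ((HasD.dotProduct_const_fst a).sq.const_mul 2)).mul
    (HasD.fst i)).add ((HasD.dotProduct_fst_self.mul (HasD.dotProduct_const_fst a)).mul
      (HasD.const (a i)))).neg).congr_deriv fun ξ ζ => by
      rw [dQuad]; ring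

theorem hasD_vel (ha : a ⬝ᵥ a = 1) (hx : x ⬝ᵥ x < 1) (hy : y ≠ 0) (i : Fin n) :
    HasD (fun x y => vel a x y i) x y (dVel a i x y) :=
  (((hasD_twist i).add ((HasD.dotProduct_const_fst a).mul (HasD.snd i))).add
    (((hasD_randersExample ha hx hy).const_mul 2).mul (hasD_quad i))).congr_deriv fun ξ ζ => by
      rw [dVel]; ring

theorem hasD_sprayVec (ha : a ⬝ᵥ a = 1) (hx : x ⬝ᵥ x < 1) (hy : y ≠ 0) (i : Fin n) :
    HasD (fun x y => sprayVec a x y i) x y (dSpray a i x y) := by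
  have hF := hasD_randersExample ha hx hy
  exact (((hF.mul (hasD_twist i)).add (hF.sq.mul (hasD_quad i))).add
    (((HasD.dotProduct_const_fst a).mul hF).mul (HasD.snd i))).congr_deriv fun ξ ζ => by
      rw [dSpray, vel]; ring

theorem hasD_conn (ha : a ⬝ᵥ a = 1) (hx : x ⬝ᵥ x < 1) (hy : y ≠ 0) (i l : Fin n) :
    HasD (fun x y => conn a x y i l) x y (dConn a i l x y) := by
  have hc : HasD (fun x _ => if i = l then a ⬝ᵥ x else 0) x y
      (fun ξ _ => if i = l then a ⬝ᵥ ξ else 0) := by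
    split_ifs
    · exact HasD.dotProduct_const_fst a
    · exact HasD.const 0
  exact (((hasD_grad ha hx hy l).mul (hasD_vel ha hx hy i)).add
    ((hasD_randersExample ha hx hy).mul (((((HasD.fst i).mul (HasD.const (a l))).sub
      ((HasD.fst l).const_mul (a i))).const_mul 2).add hc))).congr_deriv fun ξ ζ => by
      rw [dConn]; ring

theorem hasD_spray (ha : a ⬝ᵥ a = 1) (hx : x ⬝ᵥ x < 1) (hy : y ≠ 0) (i : Fin n) :
    HasD (spray (𝓕 a) i) x y (dSpray a i x y) :=
  (hasD_sprayVec ha hx hy i).congr_fun isOpen_unitBall hx hy fun _ hx _ hy =>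
    spray_randersExample ha hx hy i

theorem dSpray_single (i l : Fin n) : dSpray a i x y 0 (Pi.single l 1) = conn a x y i l := by
  simp only [dSpray, dRanders_single, dTwist, dQuad, conn, dotProduct_single_one, dotProduct_zero,
    Pi.zero_apply, Pi.single_apply]
  split_ifs <;> ring

theorem dy_spray (ha : a ⬝ᵥ a = 1) (hx : x ⬝ᵥ x < 1) (hy : y ≠ 0) (i l : Fin n) :
    dy l (spray (𝓕 a) i) x y = conn a x y i l := by
  rw [(hasD_spray ha hx hy i).dy_eq, dSpray_single]

theorem hasD_dy_spray (ha : a ⬝ᵥ a = 1) (hx : x ⬝ᵥ x < 1) (hy : y ≠ 0) (i l : Fin n) :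
    HasD (dy l (spray (𝓕 a) i)) x y (dConn a i l x y) :=
  (hasD_conn ha hx hy i l).congr_fun isOpen_unitBall hx hy fun _ hx _ hy =>
    dy_spray ha hx hy i l

theorem HasD.flow_eq {f : Scal n} {d : Coord n → Coord n → ℝ} (hf : HasD f x y d)
    (ha : a ⬝ᵥ a = 1) (hx : x ⬝ᵥ x < 1) (hy : y ≠ 0) :
    ∑ m, (y m * dx m f x y - 2 * spray (𝓕 a) m x y * dy m f x y) = d y (flowVec a x y) := by
  rw [hf.apply_eq_sum, ← Finset.sum_add_distrib]
  refine Finset.sum_congr rfl fun m _ => ?_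
  rw [spray_randersExample ha hx hy, flowVec]
  ring

/-- The two middle terms of the Riemann curvature combine into minus the derivative of `Nⁱ_k` along
the spray. -/
theorem riemann_eq (ha : a ⬝ᵥ a = 1) (hx : x ⬝ᵥ x < 1) (hy : y ≠ 0) (i k : Fin n) :
    riemann (𝓕 a) i k x y = 2 * dSpray a i x y (Pi.single k 1) 0
      - dConn a i k x y y (flowVec a x y) - ∑ m, conn a x y i m * conn a x y m k := by
  rw [riemann, (hasD_spray ha hx hy i).dx_eq, ← (hasD_dy_spray ha hx hy i k).flow_eq ha hx hy]
  simp only [dy_spray ha hx hy, Finset.sum_sub_distrib, mul_assoc, ← Finset.mul_sum,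
    mul_comm (y _)]
  ring

theorem riemann_randersExample (ha : a ⬝ᵥ a = 1) (hx : x ⬝ᵥ x < 1) (hy : y ≠ 0) (i k : Fin n) :
    riemann (𝓕 a) i k x y = (3 * (a ⬝ᵥ y) / 𝓕 a x y + 3 * (a ⬝ᵥ x) ^ 2 - 2 * (x ⬝ᵥ x)) *
      (𝓕 a x y ^ 2 * (if i = k then 1 else 0) - 𝓕 a x y * grad a k x y * y i) := by
  have hF := randersExample_pos ha hx hy
  have h1 : (fun l => grad a l x y) ⬝ᵥ (fun m => conn a x y m k) = horGrad a x y k :=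
    sum_grad_mul_conn ha hx hy k
  have h2 : ∀ t : Coord n, t ⬝ᵥ (fun m => conn a x y m k) = _ := fun t => sum_mul_conn t k
  rw [riemann_eq ha hx hy, sum_conn_mul (fun m => conn a x y m k), h1, h2, h2]
  simp only [dSpray, dConn, dVel, dRanders_flow ha hx, dGrad_flow ha hx hy,
    dRanders_horizontal hx hy, dTwist, dQuad, dotProduct_zero, dotProduct_single_one,
    Pi.zero_apply, Pi.single_apply, dotProduct_flowVec, dotProduct_sprayVec, dotProduct_vel,
    dotProduct_twist, dotProduct_quad, ha, dotProduct_comm x a, conn]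
  -- `∂F/∂xᵏ` enters the three terms as `2Vⁱ`, `-Vⁱ` and `-Vⁱ` and cancels, so its value is
  -- irrelevant.
  generalize horGrad a x y k = h
  simp only [flowVec, sprayVec, vel, twist, quad, quadratic_eq (y := y) ha hx, lam, drift0]
  rw [snd_eq (a := a) hx hy k, rad_eq ha hx, drift, lam, drift0]
  split_ifs
  · subst i
    field_simp
    ring
  · field_simp
    ring

theorem dRanders_radial (ha : a ⬝ᵥ a = 1) (hx : x ⬝ᵥ x < 1) (hy : y ≠ 0) :
    dRanders a x y 0 y = 𝓕 a x y := by
  have hr := rad_pos (a := a) hx hy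
  rw [dRanders, div_eq_iff hr.ne', quadratic_eq ha hx, rad_eq ha hx]
  simp only [dDrift0, drift0, dotProduct_zero]
  ring

theorem dRad_radial (ha : a ⬝ᵥ a = 1) (hx : x ⬝ᵥ x < 1) (hy : y ≠ 0) :
    dRad a x y 0 y = rad a x y := by
  rw [dRad, dRanders_radial ha hx hy, rad_eq ha hx]
  simp only [dDrift0, drift0, dotProduct_zero]
  ring

theorem dGrad_radial (ha : a ⬝ᵥ a = 1) (hx : x ⬝ᵥ x < 1) (hy : y ≠ 0) (l : Fin n) :
    dGrad a l x y 0 y = 0 := by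
  have hr := rad_pos (a := a) hx hy
  rw [dGrad, dRanders_radial ha hx hy, dRad_radial ha hx hy, grad]
  simp only [dotProduct_zero, Pi.zero_apply]
  field_simp
  ring

theorem sum_grad_mul_snd (ha : a ⬝ᵥ a = 1) (hx : x ⬝ᵥ x < 1) (hy : y ≠ 0) :
    ∑ m, grad a m x y * y m = 𝓕 a x y := by
  have := (hasD_randersExample ha hx hy).apply_eq_sum 0 y
  rw [dRanders_radial ha hx hy] at this
  simp only [(hasD_randersExample ha hx hy).dy_eq, dRanders_single, Pi.zero_apply] at this
  simpa [mul_comm] using this.symm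

theorem dy_randersExample (ha : a ⬝ᵥ a = 1) (hx : x ⬝ᵥ x < 1) (hy : y ≠ 0) (k : Fin n) :
    dy k (𝓕 a) x y = grad a k x y := by
  rw [(hasD_randersExample ha hx hy).dy_eq, dRanders_single]

theorem hasScalarFlagCurvature_randersExample (ha : a ⬝ᵥ a = 1) :
    HasScalarFlagCurvature {x : Coord n | x ⬝ᵥ x < 1} (𝓕 a) :=
  ⟨fun x y => 3 * (a ⬝ᵥ y) / 𝓕 a x y + 3 * (a ⬝ᵥ x) ^ 2 - 2 * (x ⬝ᵥ x),
    fun x hx y hy i k => by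
      rw [riemann_randersExample ha hx hy, dy_randersExample ha hx hy]⟩

theorem riemannTraceFree_randersExample (hn : 2 ≤ n) (ha : a ⬝ᵥ a = 1) (hx : x ⬝ᵥ x < 1)
    (hy : y ≠ 0) (i k : Fin n) :
    riemannTraceFree (𝓕 a) i k x y =
      -((3 * (a ⬝ᵥ y) + (3 * (a ⬝ᵥ x) ^ 2 - 2 * (x ⬝ᵥ x)) * 𝓕 a x y) * grad a k x y * y i) := by
  have hF := randersExample_pos ha hx hy
  have hn' : (n : ℝ) - 1 ≠ 0 := by
    have : (2 : ℝ) ≤ n := by exact_mod_cast hn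
    linarith
  simp only [riemannTraceFree, riemann_randersExample ha hx hy, ← Finset.mul_sum,
    Finset.sum_sub_distrib, mul_assoc, sum_grad_mul_snd ha hx hy, if_true, mul_one,
    Finset.sum_const, Finset.card_univ, Fintype.card_fin, nsmul_eq_mul]
  field_simp
  ring

/-- Here `Aⁱ_k = -t_k yⁱ` with `t_k = K F F_{.k}` homogeneous of degree one in `y`. By Euler's
relation the divergence `Aᵐ_{k.m}` is `-(n + 1) t_k`, and the two terms of the Weyl curvature
cancel. -/
theorem isWeylMetric_randersExample (hn : 2 ≤ n) (ha : a ⬝ᵥ a = 1) :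
    IsWeylMetric {x : Coord n | x ⬝ᵥ x < 1} (𝓕 a) := by
  intro x hx y hy i k
  set b : ℝ := 3 * (a ⬝ᵥ x) ^ 2 - 2 * (x ⬝ᵥ x) with hb
  have hF := hasD_randersExample ha hx hy
  have hr2 : HasD (fun x _ => 3 * (a ⬝ᵥ x) ^ 2 - 2 * (x ⬝ᵥ x)) x y _ :=
    ((HasD.dotProduct_const_fst a).sq.const_mul 3).sub (HasD.dotProduct_fst_self.const_mul 2)
  have ht := (((HasD.dotProduct_const_snd a).const_mul 3).add (hr2.mul hF)).mul
    (hasD_grad ha hx hy k)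
  have hd : ∀ m, dy m (riemannTraceFree (𝓕 a) m k) x y = _ := fun m =>
    (ht.mul (HasD.snd m)).neg.dy_eq_of_eqOn isOpen_unitBall hx hy
      (fun x hx y hy => riemannTraceFree_randersExample hn ha hx hy m k) m
  -- Euler's relation for `t_k`.
  have hs := ht.apply_eq_sum 0 y
  simp only [Pi.zero_apply, zero_mul, Finset.sum_const_zero, zero_add, dRanders_radial ha hx hy,
    dGrad_radial ha hx hy, dotProduct_zero, mul_zero, sub_zero, add_zero] at hs
  simp only [ht.dy_eq] at hs
  simp only [weyl, hd, riemannTraceFree_randersExample hn ha hx hy, Pi.single_eq_same,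
    Finset.sum_neg_distrib, Finset.sum_add_distrib, Finset.sum_const, Finset.card_univ,
    Fintype.card_fin, nsmul_eq_mul, mul_one]
  simp only [mul_comm (y _)] at hs
  rw [← hs]
  have hn' : (n : ℝ) + 1 ≠ 0 := by positivity
  field_simp
  ring

end

/-! ### Busemann–Hausdorff volume and `S`-curvature -/

section

variable {a x : Coord n}

theorem randersExample_lt_one_iff (ha : a ⬝ᵥ a = 1) (hx : x ⬝ᵥ x < 1) (v : Coord n) :
    𝓕 a x v < 1 ↔ (v - drift a x) ⬝ᵥ (v - drift a x) < 1 := by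
  have hl := lam_pos hx
  have hv := dot_self_nonneg v
  have h1 : (v - drift a x) ⬝ᵥ (v - drift a x) =
      v ⬝ᵥ v - 2 * drift0 a x v + (1 - lam x) := by
    simp only [sub_dotProduct, dotProduct_sub, dotProduct_comm v (drift a x), drift_dotProduct_self ha,
      drift_dotProduct, lam]
    ring
  rw [h1, randersExample_eq ha, div_lt_one hl, sub_lt_iff_lt_add, rad]
  constructor
  · intro h
    have h0 : 0 < lam x + drift0 a x v := (Real.sqrt_nonneg _).trans_lt h
    rw [Real.sqrt_lt' h0] at h
    nlinarith
  · intro h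
    -- From `0 ≤ |v|² < λ + 2W₀` and `0 < λ`.
    have h0 : 0 < lam x + drift0 a x v := by linarith
    rw [Real.sqrt_lt' h0]
    nlinarith

/-- The unit ball of `F` at `x` is the Euclidean unit ball translated by `W`, and Lebesgue measure
is translation invariant. -/
theorem bhDensity_randersExample (ha : a ⬝ᵥ a = 1) (hx : x ⬝ᵥ x < 1) :
    bhDensity (𝓕 a) x = 1 := by
  have hopen : IsOpen {v : Coord n | v ⬝ᵥ v < 1} := isOpen_unitBall
  have hsub : {v : Coord n | v ⬝ᵥ v < 1} ⊆ Metric.closedBall 0 1 := fun v hv => by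
    rw [mem_closedBall_zero_iff, pi_norm_le_iff_of_nonneg zero_le_one]
    intro i
    have h1 : v i * v i ≤ v ⬝ᵥ v :=
      Finset.single_le_sum (f := fun i => v i * v i) (fun i _ => mul_self_nonneg (v i))
        (Finset.mem_univ i)
    have h2 : v ⬝ᵥ v < 1 := hv
    rw [Real.norm_eq_abs, abs_le_one_iff_mul_self_le_one]
    linarith
  have hlt : MeasureTheory.volume {v : Coord n | v ⬝ᵥ v < 1} ≠ ⊤ :=
    ((MeasureTheory.measure_mono hsub).trans_lt MeasureTheory.measure_closedBall_lt_top).ne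
  have hpos : 0 < MeasureTheory.volume {v : Coord n | v ⬝ᵥ v < 1} :=
    hopen.measure_pos _ ⟨0, by simp⟩
  have htrans : {v : Coord n | 𝓕 a x v < 1} =
      (fun v => v + -drift a x) ⁻¹' {v : Coord n | v ⬝ᵥ v < 1} := by
    ext v
    rw [Set.mem_preimage, ← sub_eq_add_neg]
    exact randersExample_lt_one_iff ha hx v
  rw [bhDensity, htrans, MeasureTheory.measureReal_def, MeasureTheory.measureReal_def,
    MeasureTheory.measure_preimage_add_right]
  exact div_self (ENNReal.toReal_pos hpos.ne' hlt).ne'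

end

section

variable {a x y : Coord 3}

theorem distortion_randersExample (ha : a ⬝ᵥ a = 1) (hx : x ⬝ᵥ x < 1) (hy : y ≠ 0) :
    distortion (𝓕 a) x y = 2 * (Real.log (𝓕 a x y) - Real.log (rad a x y)) := by
  have hF := randersExample_pos ha hx hy
  have hr := rad_pos (a := a) hx hy
  rw [distortion, det_fundTensor ha hx hy, bhDensity_randersExample ha hx, div_one,
    show (𝓕 a x y / rad a x y) ^ 4 = ((𝓕 a x y / rad a x y) ^ 2) ^ 2 by ring,
    Real.sqrt_sq (sq_nonneg _), Real.log_pow, Real.log_div hF.ne' hr.ne']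
  norm_num

/-- The distortion is `2(log F - log A)`. Along the spray `F` is constant and `log A` has derivative
`-2⟨a,x⟩F`, which gives `4⟨a,x⟩F`. -/
theorem hasIsotropicSCurvature_randersExample (ha : a ⬝ᵥ a = 1) :
    HasIsotropicSCurvature {x : Coord 3 | x ⬝ᵥ x < 1} (𝓕 a) := by
  refine ⟨fun x => a ⬝ᵥ x, fun x hx y hy => ?_⟩
  have hF := randersExample_pos ha hx hy
  have hr := rad_pos (a := a) hx hy
  have h1 := (((hasD_randersExample ha hx hy).comp (Real.hasDerivAt_log hF.ne')).sub
    ((hasD_rad ha hx hy).comp (Real.hasDerivAt_log hr.ne'))).const_mul 2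
  have h2 := h1.congr_fun isOpen_unitBall hx hy fun _ hx _ hy =>
    distortion_randersExample ha hx hy
  rw [sCurvature, h2.flow_eq ha hx hy, dRanders_flow ha hx, dRad_flow ha hx]
  field_simp
  norm_num
  ring

end

/-! ### The Douglas curvature and its horizontal derivatives -/

/-- The components `Zⁱ_l` in the decomposition
`D_jⁱ_kl = F_{.j.k} Zⁱ_l + F_{.j.l} Zⁱ_k + F_{.k.l} Zⁱ_j` of the Douglas curvature. -/
def zed (a : Coord n) (i l : Fin n) : Scal n := fun x y =>
  2 * (x i * a l - a i * x l) + 2 * grad a l x y * quad a x i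
    - eta a l x y * (twist a x y i + 2 * 𝓕 a x y * quad a x i)

/-- The covector `u_l` with `Zⁱ_l|0 = yⁱ u_l`. -/
def covec (a : Coord n) (l : Fin n) : Scal n := fun x y =>
  2 * a l - 2 * (a ⬝ᵥ y) * eta a l x y
    + 2 * (2 * (a ⬝ᵥ x) ^ 2 - x ⬝ᵥ x) * (grad a l x y - 𝓕 a x y * eta a l x y)
    + (a ⬝ᵥ x) * (2 * skew a x y l / rad a x y)

section

variable {a x y : Coord n}

theorem sum_conn_mul_snd (ha : a ⬝ᵥ a = 1) (hx : x ⬝ᵥ x < 1) (hy : y ≠ 0) (i : Fin n) :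
    ∑ m, conn a x y i m * y m = 2 * sprayVec a x y i := by
  have h : (fun l => grad a l x y) ⬝ᵥ y = 𝓕 a x y := sum_grad_mul_snd ha hx hy
  rw [sum_conn_mul, h, sprayVec, vel, twist]
  ring

theorem dConn_radial (ha : a ⬝ᵥ a = 1) (hx : x ⬝ᵥ x < 1) (hy : y ≠ 0) (i l : Fin n) :
    dConn a i l x y 0 y = conn a x y i l := by
  simp only [dConn, dGrad_radial ha hx hy, dRanders_radial ha hx hy, dVel, dTwist, dQuad,
    dotProduct_zero, Pi.zero_apply, conn, vel, twist, ite_self]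
  ring

theorem nonlinConn_randersExample (ha : a ⬝ᵥ a = 1) (hx : x ⬝ᵥ x < 1) (hy : y ≠ 0)
    (i l : Fin n) : nonlinConn (𝓕 a) i l x y = conn a x y i l :=
  dy_spray ha hx hy i l

theorem sum_berwaldConn_mul_snd (ha : a ⬝ᵥ a = 1) (hx : x ⬝ᵥ x < 1) (hy : y ≠ 0)
    (i l : Fin n) : ∑ m, berwaldConn (𝓕 a) i l m x y * y m = conn a x y i l := by
  have h : HasD (nonlinConn (𝓕 a) i l) x y (dConn a i l x y) := hasD_dy_spray ha hx hy i l
  have h' := h.apply_eq_sum 0 y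
  rw [dConn_radial ha hx hy] at h'
  rw [h']
  simp [berwaldConn, mul_comm]

/-- By homogeneity, contracting with `yᵐ` turns `Nʳ_m` into `2Gʳ` and the Berwald coefficients into
`N`. No derivative of the connection survives, and one differential of `T` suffices. -/
theorem hDeriv0_eq (ha : a ⬝ᵥ a = 1) (hx : x ⬝ᵥ x < 1) (hy : y ≠ 0) {T : Tensor13 n}
    {i j k l : Fin n} {d : Coord n → Coord n → ℝ} (hT : HasD (T i j k l) x y d) :
    hDeriv0 (𝓕 a) T i j k l x y = d y (flowVec a x y)
      + ∑ r, conn a x y i r * T r j k l x y - ∑ r, conn a x y r j * T i r k l x y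
      - ∑ r, conn a x y r k * T i j r l x y - ∑ r, conn a x y r l * T i j k r x y := by
  have hs : ∀ c t : Fin n → Fin n → ℝ, ∑ m, (∑ r, c r m * t r m) * y m =
      ∑ r, ∑ m, c r m * t r m * y m := fun c t => by
    simp only [Finset.sum_mul]
    exact Finset.sum_comm
  have hb : ∀ (p q : Fin n → Fin n) (t : Fin n → ℝ),
      ∑ m, (∑ r, berwaldConn (𝓕 a) (p r) (q r) m x y * t r) * y m =
        ∑ r, conn a x y (p r) (q r) * t r := fun p q t => by
    rw [hs (fun r m => berwaldConn (𝓕 a) (p r) (q r) m x y) fun r _ => t r]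
    refine Finset.sum_congr rfl fun r _ => ?_
    rw [← sum_berwaldConn_mul_snd ha hx hy, Finset.sum_mul]
    exact Finset.sum_congr rfl fun m _ => by ring
  have hn : ∑ m, (∑ r, nonlinConn (𝓕 a) r m x y * dy r (T i j k l) x y) * y m =
      ∑ r, 2 * sprayVec a x y r * dy r (T i j k l) x y := by
    rw [hs (fun r m => nonlinConn (𝓕 a) r m x y) fun r _ => dy r (T i j k l) x y]
    refine Finset.sum_congr rfl fun r _ => ?_
    rw [← sum_conn_mul_snd ha hx hy, Finset.sum_mul]
    exact Finset.sum_congr rfl fun m _ => by rw [nonlinConn_randersExample ha hx hy]; ring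
  rw [← hT.flow_eq ha hx hy]
  simp only [hDeriv0, hDeriv, add_mul, sub_mul, Finset.sum_add_distrib, Finset.sum_sub_distrib,
    hn, spray_randersExample ha hx hy]
  rw [hb (fun _ => i) (fun r => r) fun r => T r j k l x y,
    hb (fun r => r) (fun _ => j) fun r => T i r k l x y,
    hb (fun r => r) (fun _ => k) fun r => T i j r l x y,
    hb (fun r => r) (fun _ => l) fun r => T i j k r x y]
  simp only [mul_comm (y _)]

/-- Leibniz rule with `F_{.j.k|0} = 0`. It is stated for general `Z` because it is used twice: for
the Douglas curvature, and for `D̃` with `Z` replaced by `yⁱu_l`. -/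
theorem hDeriv0_hess_mul (ha : a ⬝ᵥ a = 1) (hx : x ⬝ᵥ x < 1) (hy : y ≠ 0) {T : Tensor13 n}
    {Z : Fin n → Fin n → Scal n} {dZ : Fin n → Fin n → Coord n → Coord n → ℝ}
    (hT : ∀ i j k l, ∀ x ∈ {x : Coord n | x ⬝ᵥ x < 1}, ∀ y, y ≠ 0 → T i j k l x y =
      hess a j k x y * Z i l x y + hess a j l x y * Z i k x y + hess a k l x y * Z i j x y)
    (hZ : ∀ i l, HasD (Z i l) x y (dZ i l)) {Zh : Fin n → Fin n → ℝ}
    (hZh : ∀ i l, Zh i l = dZ i l y (flowVec a x y) + ∑ r, conn a x y i r * Z r l x y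
      - ∑ r, conn a x y r l * Z i r x y) (i j k l : Fin n) :
    hDeriv0 (𝓕 a) T i j k l x y =
      hess a j k x y * Zh i l + hess a j l x y * Zh i k + hess a k l x y * Zh i j := by
  have hh : ∀ j k, HasD (hess a j k) x y (dHess a j k x y) := hasD_hess ha hx hy
  have hd := ((((hh j k).mul (hZ i l)).add ((hh j l).mul (hZ i k))).add
    ((hh k l).mul (hZ i j))).congr_fun isOpen_unitBall hx hy (hT i j k l)
  have h1 : ∀ (c : Fin n → ℝ) (s1 s2 s3 t1 t2 t3 : Fin n → ℝ),
      ∑ r, c r * (s1 r * t1 r + s2 r * t2 r + s3 r * t3 r) =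
        ∑ r, c r * s1 r * t1 r + ∑ r, c r * s2 r * t2 r + ∑ r, c r * s3 r * t3 r :=
    fun c s1 s2 s3 t1 t2 t3 => by
      simp only [mul_add, Finset.sum_add_distrib, mul_assoc]
  have h2 : ∀ (c t : Fin n → ℝ) (s : ℝ), ∑ r, c r * s * t r = s * ∑ r, c r * t r :=
    fun c t s => by
      rw [Finset.mul_sum]
      exact Finset.sum_congr rfl fun r _ => by ring
  have h3 : ∀ (c t : Fin n → ℝ) (s : ℝ), ∑ r, c r * t r * s = (∑ r, c r * t r) * s :=
    fun c t s => by rw [Finset.sum_mul]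
  rw [hDeriv0_eq ha hx hy hd]
  simp only [hT _ _ _ _ x hx y hy, h1, h2, h3, dHess_flow ha hx hy, hZh]
  ring

theorem hasD_zed (ha : a ⬝ᵥ a = 1) (hx : x ⬝ᵥ x < 1) (hy : y ≠ 0) (i l : Fin n) :
    HasD (zed a i l) x y (fun ξ ζ => 2 * (ξ i * a l - a i * ξ l)
      + 2 * dGrad a l x y ξ ζ * quad a x i + 2 * grad a l x y * dQuad a i x ξ
      - dEta a l x y ξ ζ * (twist a x y i + 2 * 𝓕 a x y * quad a x i)
      - eta a l x y * (dTwist a i x y ξ ζ + 2 * dRanders a x y ξ ζ * quad a x i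
        + 2 * 𝓕 a x y * dQuad a i x ξ)) :=
  ((((((HasD.fst i).mul (HasD.const (a l))).sub ((HasD.fst l).const_mul (a i))).const_mul 2).add
    (((hasD_grad ha hx hy l).const_mul 2).mul (hasD_quad i))).sub
    ((hasD_eta ha hx hy l).mul ((hasD_twist i).add
      (((hasD_randersExample ha hx hy).const_mul 2).mul (hasD_quad i))))).congr_deriv
    fun ξ ζ => by ring

theorem dotProduct_zed (t : Coord n) (l : Fin n) : t ⬝ᵥ (fun r => zed a r l x y) =
    2 * ((t ⬝ᵥ x) * a l - (t ⬝ᵥ a) * x l) + 2 * grad a l x y * (t ⬝ᵥ quad a x)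
      - eta a l x y * (t ⬝ᵥ twist a x y + 2 * 𝓕 a x y * (t ⬝ᵥ quad a x)) := by
  have : (fun r => zed a r l x y) = (2 * a l) • x - (2 * x l) • a
      + (2 * grad a l x y) • quad a x
      - eta a l x y • (twist a x y + (2 * 𝓕 a x y) • quad a x) := by
    ext i
    simp [zed]
    ring
  rw [this]
  simp only [dotProduct_sub, dotProduct_add, dotProduct_smul, smul_eq_mul]
  ring

theorem sum_conn_mul_zed (ha : a ⬝ᵥ a = 1) (hx : x ⬝ᵥ x < 1) (hy : y ≠ 0) (i l : Fin n) :
    ∑ r, conn a x y r l * zed a i r x y =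
      2 * x i * (∑ r, a r * conn a x y r l) - 2 * a i * (∑ r, x r * conn a x y r l)
      + 2 * quad a x i * horGrad a x y l
      - (twist a x y i + 2 * 𝓕 a x y * quad a x i) * ∑ r, eta a r x y * conn a x y r l := by
  have : ∀ r, conn a x y r l * zed a i r x y = 2 * x i * (a r * conn a x y r l)
      - 2 * a i * (x r * conn a x y r l) + 2 * quad a x i * (grad a r x y * conn a x y r l)
      - (twist a x y i + 2 * 𝓕 a x y * quad a x i) * (eta a r x y * conn a x y r l) :=
    fun r => by rw [zed]; ring
  simp only [this, Finset.sum_add_distrib, Finset.sum_sub_distrib, ← Finset.mul_sum,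
    sum_grad_mul_conn ha hx hy]

theorem grad_dotProduct_zed (ha : a ⬝ᵥ a = 1) (l : Fin n) :
    (fun l => grad a l x y) ⬝ᵥ (fun r => zed a r l x y) = 2 * skew a x y l / rad a x y := by
  rw [grad_dotProduct, dotProduct_zed, dotProduct_zed]
  congr 1
  simp only [skew, cross, drift_dotProduct, drift0, dotProduct_twist, dotProduct_quad, quad, ha,
    dotProduct_comm x a, dotProduct_comm y a, dotProduct_comm y x]
  ring

/-- The crucial identity `Zⁱ_l|0 = yⁱu_l`: the right side is `Zⁱ_l|0` written out, and all its parts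
not proportional to `yⁱ` cancel. -/
theorem zed_horizontal (ha : a ⬝ᵥ a = 1) (hx : x ⬝ᵥ x < 1) (hy : y ≠ 0) (i l : Fin n) :
    y i * covec a l x y = 2 * (y i * a l - a i * y l)
      + 2 * dGrad a l x y y (flowVec a x y) * quad a x i + 2 * grad a l x y * dQuad a i x y
      - dEta a l x y y (flowVec a x y) * (twist a x y i + 2 * 𝓕 a x y * quad a x i)
      - eta a l x y * (dTwist a i x y y (flowVec a x y)
        + 2 * dRanders a x y y (flowVec a x y) * quad a x i + 2 * 𝓕 a x y * dQuad a i x y)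
      + ∑ r, conn a x y i r * zed a r l x y - ∑ r, conn a x y r l * zed a i r x y := by
  have hr := rad_pos (a := a) hx hy
  rw [sum_conn_mul (fun r => zed a r l x y), sum_conn_mul_zed ha hx hy, dGrad_flow ha hx hy,
    dEta_flow ha hx hy, dRanders_flow ha hx, sum_mul_conn a, sum_mul_conn x]
  simp only [grad_dotProduct_zed ha, covec, dotProduct_zed]
  generalize ∑ r, eta a r x y * conn a x y r l = s
  generalize horGrad a x y l = h
  generalize 2 * skew a x y l / rad a x y = e
  have hη : rad a x y * eta a l x y = lam x * grad a l x y + drift a x l := by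
    rw [eta, mul_div_cancel₀ _ hr.ne']
  simp only [dTwist, dQuad, dotProduct_flowVec,
    dotProduct_sprayVec, dotProduct_vel, dotProduct_twist, dotProduct_quad, zed,
    ha, dotProduct_comm x a, vel, twist, quad, quadratic_eq (y := y) ha hx]
  rw [snd_eq (a := a) hx hy l]
  rw [rad_eq ha hx] at hη ⊢
  simp only [drift, drift0, lam] at hη ⊢
  -- The defining relation `Aη_l = λF_{.l} + W_l` of `η` is the only one still needed.
  linear_combination (-2 * 𝓕 a x y * a i) * hη

end

section

variable {a x y : Coord n}

/-- The trace term of the Douglas tensor is therefore `⟨a,x⟩Fy`, exactly the last summand of `G`;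
only `Fp + F²q` contributes to the Douglas curvature. -/
theorem sum_conn_self (ha : a ⬝ᵥ a = 1) (hx : x ⬝ᵥ x < 1) (hy : y ≠ 0) :
    ∑ m, conn a x y m m = ((n : ℝ) + 1) * ((a ⬝ᵥ x) * 𝓕 a x y) := by
  have h : ∀ m, conn a x y m m = grad a m x y * vel a x y m + 𝓕 a x y * (a ⬝ᵥ x) := fun m => by
    rw [conn, if_pos rfl]; ring
  have h' : ∑ m, grad a m x y * vel a x y m = (a ⬝ᵥ x) * 𝓕 a x y := grad_dotProduct_vel ha hx hy
  simp only [h, Finset.sum_add_distrib, h', Finset.sum_const, Finset.card_univ, Fintype.card_fin,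
    nsmul_eq_mul]
  ring

theorem dVel_single (i k : Fin n) : dVel a i x y 0 (Pi.single k 1) =
    2 * (x i * a k - a i * x k) + (if i = k then a ⬝ᵥ x else 0)
      + 2 * grad a k x y * quad a x i := by
  simp only [dVel, dTwist, dQuad, dRanders_single, dotProduct_single_one, dotProduct_zero,
    Pi.zero_apply, Pi.single_apply]
  split_ifs <;> ring

theorem dy_dy_spray (ha : a ⬝ᵥ a = 1) (hx : x ⬝ᵥ x < 1) (hy : y ≠ 0) (i k l : Fin n) :
    dy k (dy l (spray (𝓕 a) i)) x y = hess a k l x y * vel a x y i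
      + grad a l x y * (2 * (x i * a k - a i * x k) + (if i = k then a ⬝ᵥ x else 0)
        + 2 * grad a k x y * quad a x i)
      + grad a k x y * (2 * (x i * a l - a i * x l) + if i = l then a ⬝ᵥ x else 0) := by
  rw [(hasD_dy_spray ha hx hy i l).dy_eq, dConn, dGrad_single hx hy, dVel_single,
    dRanders_single, hess_symm l k]
  simp only [Pi.zero_apply, dotProduct_zero, ite_self]
  ring

theorem dy_dy_dy_spray (ha : a ⬝ᵥ a = 1) (hx : x ⬝ᵥ x < 1) (hy : y ≠ 0) (i j k l : Fin n) :
    dy j (dy k (dy l (spray (𝓕 a) i))) x y =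
      hess a j k x y * (2 * (x i * a l - a i * x l) + (if i = l then a ⬝ᵥ x else 0)
        + 2 * grad a l x y * quad a x i - eta a l x y * vel a x y i)
      + hess a j l x y * (2 * (x i * a k - a i * x k) + (if i = k then a ⬝ᵥ x else 0)
        + 2 * grad a k x y * quad a x i - eta a k x y * vel a x y i)
      + hess a k l x y * (2 * (x i * a j - a i * x j) + (if i = j then a ⬝ᵥ x else 0)
        + 2 * grad a j x y * quad a x i - eta a j x y * vel a x y i) := by
  have hc : ∀ k, HasD (fun x _ => 2 * (x i * a k - a i * x k) + if i = k then a ⬝ᵥ x else 0) x y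
      (fun ξ _ => 2 * (ξ i * a k - a i * ξ k) + if i = k then a ⬝ᵥ ξ else 0) := fun k => by
    refine HasD.add ((((HasD.fst i).mul (HasD.const (a k))).sub
      ((HasD.fst k).const_mul (a i))).const_mul 2 |>.congr_deriv fun ξ ζ => by ring) ?_
    split_ifs
    · exact HasD.dotProduct_const_fst a
    · exact HasD.const 0
  have hg := hasD_grad (y := y) ha hx hy
  have h := (((hasD_hess ha hx hy k l).mul (hasD_vel ha hx hy i)).add
    ((hg l).mul ((hc k).add (((hg k).const_mul 2).mul (hasD_quad (a := a) i))))).add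
      ((hg k).mul (hc l))
  rw [h.dy_eq_of_eqOn isOpen_unitBall hx hy fun _ hx _ hy => dy_dy_spray ha hx hy i k l]
  rw [dHess_single hx hy, dVel_single, dGrad_single hx hy, dGrad_single hx hy,
    hess_symm k j, hess_symm l j]
  simp only [dQuad, Pi.zero_apply, dotProduct_zero, ite_self]
  ring

theorem dy_dy_dy_trace (ha : a ⬝ᵥ a = 1) (hx : x ⬝ᵥ x < 1) (hy : y ≠ 0) (i j k l : Fin n) :
    dy j (dy k (dy l (fun x y => (∑ m, dy m (spray (𝓕 a) m) x y) * y i))) x y =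
      ((n : ℝ) + 1) * (a ⬝ᵥ x) * (
        hess a j k x y * ((if i = l then 1 else 0) - eta a l x y * y i)
        + hess a j l x y * ((if i = k then 1 else 0) - eta a k x y * y i)
        + hess a k l x y * ((if i = j then 1 else 0) - eta a j x y * y i)) := by
  have hc : ∀ x y : Coord n, HasD (fun x _ => ((n : ℝ) + 1) * (a ⬝ᵥ x)) x y
      (fun ξ _ => ((n : ℝ) + 1) * (a ⬝ᵥ ξ)) := fun x y =>
    (HasD.dotProduct_const_fst a).const_mul _
  have h1 : ∀ x ∈ {x : Coord n | x ⬝ᵥ x < 1}, ∀ y, y ≠ 0 →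
      dy l (fun x y => (∑ m, dy m (spray (𝓕 a) m) x y) * y i) x y =
        ((n : ℝ) + 1) * (a ⬝ᵥ x) *
          (grad a l x y * y i + 𝓕 a x y * if i = l then 1 else 0) := fun x hx y hy => by
    have h := (hc x y).mul ((hasD_randersExample ha hx hy).mul (HasD.snd i))
    rw [h.dy_eq_of_eqOn isOpen_unitBall hx hy fun x hx y hy => by
      simp only [dy_spray ha hx hy, sum_conn_self ha hx hy]; ring]
    simp only [dRanders_single, dotProduct_zero, Pi.single_apply]
    ring
  have h2 : ∀ x ∈ {x : Coord n | x ⬝ᵥ x < 1}, ∀ y, y ≠ 0 →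
      dy k (dy l (fun x y => (∑ m, dy m (spray (𝓕 a) m) x y) * y i)) x y =
        ((n : ℝ) + 1) * (a ⬝ᵥ x) * (hess a k l x y * y i
          + grad a l x y * (if i = k then 1 else 0)
          + grad a k x y * if i = l then 1 else 0) := fun x hx y hy => by
    have h := (hc x y).mul (((hasD_grad ha hx hy l).mul (HasD.snd i)).add
      ((hasD_randersExample ha hx hy).mul (HasD.const (if i = l then 1 else 0))))
    rw [h.dy_eq_of_eqOn isOpen_unitBall hx hy h1]
    simp only [dRanders_single, dGrad_single hx hy, dotProduct_zero, Pi.single_apply,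
      hess_symm l k]
    ring
  have h := (hc x y).mul ((((hasD_hess ha hx hy k l).mul (HasD.snd i)).add
    ((hasD_grad ha hx hy l).mul (HasD.const (if i = k then 1 else 0)))).add
      ((hasD_grad ha hx hy k).mul (HasD.const (if i = l then 1 else 0))))
  rw [h.dy_eq_of_eqOn isOpen_unitBall hx hy h2]
  simp only [dHess_single hx hy, dGrad_single hx hy, dotProduct_zero, Pi.single_apply, hess_symm k j,
    hess_symm l j]
  ring

/-- The third derivative of `Fp + F²q` is `F_{.j.k.l}(p + 2Fq)` plus the symmetrization of
`F_{.j.k}(p_{.l} + 2F_{.l}q)`. Expressing `F_{.j.k.l}` through `η` collects the factor `Z`. -/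
theorem douglas_randersExample (ha : a ⬝ᵥ a = 1) (hx : x ⬝ᵥ x < 1) (hy : y ≠ 0)
    (i j k l : Fin n) : douglas (𝓕 a) i j k l x y =
      hess a j k x y * zed a i l x y + hess a j l x y * zed a i k x y
        + hess a k l x y * zed a i j x y := by
  have hn : (n : ℝ) + 1 ≠ 0 := by positivity
  rw [douglas, dy_dy_dy_spray ha hx hy, dy_dy_dy_trace ha hx hy, mul_assoc _ (a ⬝ᵥ x),
    one_div, inv_mul_cancel_left₀ hn]
  simp only [zed, vel]
  split_ifs <;> ring

theorem dTilde_randersExample (ha : a ⬝ᵥ a = 1) (hx : x ⬝ᵥ x < 1) (hy : y ≠ 0)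
    (i j k l : Fin n) : dTilde (𝓕 a) i j k l x y =
      hess a j k x y * (y i * covec a l x y) + hess a j l x y * (y i * covec a k x y)
        + hess a k l x y * (y i * covec a j x y) :=
  hDeriv0_hess_mul ha hx hy (fun i j k l _ hx _ hy => douglas_randersExample ha hx hy i j k l)
    (hasD_zed ha hx hy) (fun i l => zed_horizontal ha hx hy i l) i j k l

/-- Since `yⁱ_{|0} = 0`, only `u_l` is differentiated, and `v_l` is `u_{l|0}`. -/
theorem hDeriv0_dTilde_randersExample (ha : a ⬝ᵥ a = 1) (hx : x ⬝ᵥ x < 1) (hy : y ≠ 0)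
    {d : Fin n → Coord n → Coord n → ℝ} (hd : ∀ l, HasD (covec a l) x y (d l)) {v : Fin n → ℝ}
    (hv : ∀ l, v l = d l y (flowVec a x y) - ∑ r, covec a r x y * conn a x y r l)
    (i j k l : Fin n) : hDeriv0 (𝓕 a) (dTilde (𝓕 a)) i j k l x y =
      hess a j k x y * (y i * v l) + hess a j l x y * (y i * v k)
        + hess a k l x y * (y i * v j) := by
  refine hDeriv0_hess_mul ha hx hy (Z := fun i l x y => y i * covec a l x y)
    (Zh := fun i l => y i * v l)
    (fun i j k l _ hx _ hy => dTilde_randersExample ha hx hy i j k l)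
    (fun i l => (HasD.snd i).mul (hd l)) (fun i l => ?_) i j k l
  have h1 : ∑ r, conn a x y i r * (y r * covec a l x y) =
      2 * sprayVec a x y i * covec a l x y := by
    rw [← sum_conn_mul_snd ha hx hy, Finset.sum_mul]
    exact Finset.sum_congr rfl fun r _ => by ring
  have h2 : ∑ r, conn a x y r l * (y i * covec a r x y) =
      y i * ∑ r, covec a r x y * conn a x y r l := by
    rw [Finset.mul_sum]
    exact Finset.sum_congr rfl fun r _ => by ring
  rw [h1, h2, hv, flowVec]
  ring

theorem exists_hasD_skew (ha : a ⬝ᵥ a = 1) (hx : x ⬝ᵥ x < 1) (hy : y ≠ 0) (l : Fin n) :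
    ∃ d, HasD (fun x y => 2 * skew a x y l / rad a x y) x y d :=
  ⟨_, ((((hasD_grad ha hx hy l).mul (HasD.dotProduct HasD.snd (hasD_quad (a := a)))).add
    ((((HasD.dotProduct_fst_snd.const_mul (a l)).sub
      ((HasD.fst l).mul (HasD.dotProduct_const_snd a))).sub
      ((hasD_randersExample ha hx hy).mul (hasD_quad (a := a) l))))).const_mul 2).div
    (hasD_rad ha hx hy) (rad_pos hx hy).ne'⟩

/-- At a point where `a`, `x`, `y` are orthogonal, the covariant derivative of `u_l` along the
spray is a positive multiple of `x_l` modulo `a_l` and `y_l`. -/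
theorem exists_covec_horizontal (ha : a ⬝ᵥ a = 1) (hx : x ⬝ᵥ x < 1) (hy : y ≠ 0)
    (hax : a ⬝ᵥ x = 0) (hay : a ⬝ᵥ y = 0) (hxy : x ⬝ᵥ y = 0) :
    ∃ d : Fin n → Coord n → Coord n → ℝ, (∀ l, HasD (covec a l) x y (d l)) ∧
      ∀ l, a l = 0 → y l = 0 →
        d l y (flowVec a x y) - ∑ r, covec a r x y * conn a x y r l =
          (4 * 𝓕 a x y + 4 * (x ⬝ᵥ x) ^ 2 * 𝓕 a x y ^ 2 / rad a x y) * x l := by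
  choose e he using exists_hasD_skew (a := a) ha hx hy
  have hc : HasD (fun x _ => a ⬝ᵥ x) x y _ := HasD.dotProduct_const_fst a
  have ha0 : HasD (fun _ y => a ⬝ᵥ y) x y _ := HasD.dotProduct_const_snd a
  have hF := hasD_randersExample ha hx hy
  refine ⟨_, fun l => (((HasD.const (2 * a l)).sub ((ha0.const_mul 2).mul
    (hasD_eta ha hx hy l))).add ((((hc.sq.const_mul 2).sub HasD.dotProduct_fst_self).const_mul 2).mul
      ((hasD_grad ha hx hy l).sub (hF.mul (hasD_eta ha hx hy l))))).add (hc.mul (he l)),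
    fun l hal hyl => ?_⟩
  -- In a direction orthogonal to `a` and `y`, the quantities `W_l`, `F_{.l}` and `η_l` all vanish.
  have hW : drift a x l = 0 := by rw [drift, hal, hax]; ring
  have hf : grad a l x y = 0 := by rw [grad, hyl, hW]; simp
  have hη : eta a l x y = 0 := by rw [eta, hf, hW]; simp
  have hs : ∑ r, covec a r x y * conn a x y r l = 2 * (∑ r, a r * conn a x y r l)
      - 2 * (x ⬝ᵥ x) * (horGrad a x y l - 𝓕 a x y * ∑ r, eta a r x y * conn a x y r l) := by
    have : ∀ r, covec a r x y * conn a x y r l = 2 * (a r * conn a x y r l)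
        - 2 * (x ⬝ᵥ x) * (grad a r x y * conn a x y r l
          - 𝓕 a x y * (eta a r x y * conn a x y r l)) := fun r => by
      rw [covec, hax, hay]; ring
    simp only [this, Finset.sum_sub_distrib, ← Finset.mul_sum, sum_grad_mul_conn ha hx hy]
  rw [hs, sum_mul_conn a]
  simp only [hf, hη, hax, hay, hal, dRanders_flow ha hx, dGrad_flow ha hx hy, dEta_flow ha hx hy,
    -- Two contributions remain: `4F x_l` from the rotation part of `-2 a_r Nʳ_l`, and the rest from
    -- the term `2e_l/A` of `η_{l|0}`, where `e_l = F|x|² x_l`.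
    skew, cross, quad, hxy, ha]
  ring

end

/-! ### Failure of the generalized `D̃` equation -/

/-- `F` is not a generalized `D̃`-metric. -/
theorem not_isGeneralizedDTildeMetric_randersExample :
    ¬ IsGeneralizedDTildeMetric unitBall3 (𝓕 ![-1, 0, 0]) := by
  rintro ⟨μ, hμ⟩
  -- Any mutually orthogonal nonzero `x`, `y`, both orthogonal to `a`, with `|x| < 1` would do; they
  -- are taken along the coordinate axes.
  set a : Coord 3 := ![-1, 0, 0] with ha'
  set x : Coord 3 := ![0, 1 / 2, 0] with hx'
  set y : Coord 3 := ![0, 0, 1] with hy'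
  have ha : a ⬝ᵥ a = 1 := by simp [ha', dotProduct, Fin.sum_univ_three]
  have hxx : x ⬝ᵥ x = 1 / 4 := by simp [hx', dotProduct, Fin.sum_univ_three]; norm_num
  have hx : x ⬝ᵥ x < 1 := by rw [hxx]; norm_num
  have hy2 : y 2 = 1 := rfl
  have hy : y ≠ 0 := fun h => by simp [h] at hy2
  have hax : a ⬝ᵥ x = 0 := by simp [ha', hx', dotProduct, Fin.sum_univ_three]
  have hay : a ⬝ᵥ y = 0 := by simp [ha', hy', dotProduct, Fin.sum_univ_three]
  have hxy : x ⬝ᵥ y = 0 := by simp [hx', hy', dotProduct, Fin.sum_univ_three]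
  have ha1 : a 1 = 0 := rfl
  have hy1 : y 1 = 0 := rfl
  have hx1 : x 1 = 1 / 2 := rfl
  have hF := randersExample_pos ha hx hy
  have hr := rad_pos (a := a) hx hy
  obtain ⟨d, hd, hv⟩ := exists_covec_horizontal ha hx hy hax hay hxy
  -- The upper index is the direction of `y`, so `yⁱ = 1`; the lower ones are the direction of `x`,
  -- where `u` vanishes and removes `μ`, while `u_{|0}` is positive.
  have h := hμ x hx y hy 2 1 1 1
  have hW : drift a x 1 = 0 := by rw [drift, ha1, hax]; ring
  have hf : grad a 1 x y = 0 := by rw [grad, hy1, hW]; simp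
  have hη : eta a 1 x y = 0 := by rw [eta, hf, hW]; simp
  have hu : covec a 1 x y = 0 := by
    rw [covec, ha1, hay, hax, hf, hη]; ring
  have hh : hess a 1 1 x y = 1 / rad a x y := by
    rw [hess, hf, if_pos rfl]; simp
  simp only [dTilde_randersExample ha hx hy,
    hDeriv0_dTilde_randersExample ha hx hy hd (fun _ => rfl), hu, hv 1 ha1 hy1, hh, hy2, hx1,
    mul_zero, add_zero, Finset.sum_const_zero, zero_mul, hxx] at h
  have : 0 < 1 / rad a x y * (1 * ((4 * 𝓕 a x y
      + 4 * (1 / 4 : ℝ) ^ 2 * 𝓕 a x y ^ 2 / rad a x y) * (1 / 2))) := by positivity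
  linarith

end Finsler

end

theorem mainTheorem8 :
    Finsler.IsFinslerMetric Finsler.unitBall3 (Finsler.randersExample ![-1, 0, 0]) ∧
    Finsler.IsRandersMetric Finsler.unitBall3 (Finsler.randersExample ![-1, 0, 0]) ∧
    Finsler.HasScalarFlagCurvature Finsler.unitBall3 (Finsler.randersExample ![-1, 0, 0]) ∧
    Finsler.HasIsotropicSCurvature Finsler.unitBall3 (Finsler.randersExample ![-1, 0, 0]) ∧
    Finsler.IsWeylMetric Finsler.unitBall3 (Finsler.randersExample ![-1, 0, 0]) ∧
    ¬ Finsler.IsGeneralizedDTildeMetric Finsler.unitBall3 (Finsler.randersExample ![-1, 0, 0]) := by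
  have ha : (![-1, 0, 0] : Finsler.Coord 3) ⬝ᵥ ![-1, 0, 0] = 1 := by
    simp [dotProduct, Fin.sum_univ_three]
  exact ⟨Finsler.isFinslerMetric_randersExample ha, Finsler.isRandersMetric_randersExample ha,
    Finsler.hasScalarFlagCurvature_randersExample ha,
    Finsler.hasIsotropicSCurvature_randersExample ha,
    Finsler.isWeylMetric_randersExample (by norm_num) ha,
    Finsler.not_isGeneralizedDTildeMetric_randersExample⟩
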